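/- Let $\gamma\ge 0$, let $\Theta\subset\mathbb{R}^d$ be compact and $\theta_0\in\Theta$. Let $(\epsilon_t)_{t\in\mathbb{Z}}$ be i.i.d. with density $f_\epsilon$, mean zero and unit variance, and let $(X_t)_{t\in\mathbb{Z}}$ be a strictly stationary ergodic process with $X_t=\sigma_t(\theta_0)\epsilon_t$, where, with $\mathcal F_t=\sigma(X_s: s\le t)$, $\epsilon_t$ is independent of $\mathcal F_{t-1}$ and, for every $\theta\in\Theta$, $\sigma_t(\theta)>0$ is $\mathcal F_{t-1}$-measurable. The model is identifiable: if $\theta\in\Theta$ and $\sigma_t(\theta)=\sigma_t(\theta_0)$ a.s. for all $t$, then $\theta=\theta_0$. Let the positive random variables $\tilde\sigma_t(\theta)$, $t\ge 1$, be proxies of $\sigma_t(\theta)$. Put $f_\theta(x|\mathcal F_{t-1})=\sigma_t(\theta)^{-1}f_\epsilon(x/\sigma_t(\theta))$ and $$q_t(\theta)=\begin{cases}\dfrac1\gamma f_\theta^{\gamma}(X_t|\mathcal F_{t-1})-\dfrac1{1+\gamma}\displaystyle\int f_\theta^{1+\gamma}(x|\mathcal F_{t-1})\,dx,&\gamma>0,\\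 \log f_\theta(X_t|\mathcal F_{t-1}),&\gamma=0,\end{cases}$$ and let $\tilde q_t(\theta)$ be defined in the same way from $\tilde\sigma_t(\theta)$. These quantities are supposed to be well defined and finite: $\int f_\epsilon^{1+\gamma}<\infty$ and, if $\gamma=0$, almost surely the arguments of the logarithms are positive for all $\theta\in\Theta$ and all $t$ ($t\ge1$ for the proxies). Let the minimum density power divergence estimator (MDPDE) $\hat\theta_{\gamma,n}$ be a random vector which a.s. maximizes $\widetilde Q_n(\theta)=\sum_{t=1}^n\tilde q_t(\theta)$ over $\Theta$, for each $n\ge 1$. Below, $\|\cdot\|$ is the $\ell_1$ norm of vectors and matrices. Consider the following conditions. A1. For each $t$, $q_t$ is a.s. continuous on $\Theta$, and the sequence of random functions $\{q_t(\cdot)\mid t\in\mathbb{Z}\}$ on $\Theta$ is strictly stationary and ergodic. A2. $E\sup_{\theta\in\Theta}|q_t(\theta)|<\infty$ and $\frac1n\sum_{t=1}^n\sup_{\theta\in\Theta}|q_t(\theta)-\tilde q_t(\theta)|\to0$ a.s. A3. $\{\partial_\theta q_t(\theta_0),\mathcal F_t\mid t\in\mathbb{Z}\}$ is a martingale difference sequence.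 A4. $\frac1{\sqrt n}\sum_{t=1}^n\|\partial_\theta q_t(\theta_0)-\partial_\theta\tilde q_t(\theta_0)\|\to0$ a.s. A5. For some neighbourhood $N_1$ of $\theta_0$, $\frac1n\sum_{t=1}^n\sup_{\theta\in N_1}\|\partial^2_{\theta\theta'}q_t(\theta)-\partial^2_{\theta\theta'}\tilde q_t(\theta)\|\to0$ a.s. A6. For some neighbourhood $N_2$ of $\theta_0$, $E\sup_{\theta\in N_2}\|\partial^2_{\theta\theta'}q_t(\theta)\|<\infty$. A7. The matrices $\mathcal J_\gamma=-E[\partial^2_{\theta\theta'}q_t(\theta_0)]$ and $\mathcal I_\gamma=E[\partial_\theta q_t(\theta_0)\,\partial_{\theta'}q_t(\theta_0)]$ exist, and $\mathcal J_\gamma$ is positive definite. Theorem. If A1 and A2 hold, then $\hat\theta_{\gamma,n}\to\theta_0$ almost surely. If, moreover, $\theta_0$ is an interior point of $\Theta$, the functions $q_t$ ($t\in\mathbb{Z}$) and $\tilde q_t$ ($t\ge1$) are a.s. all twice continuously differentiable on some fixed neighbourhood of $\theta_0$, and A3–A7 hold, then $$\sqrt n(\hat\theta_{\gamma,n}-\theta_0)\xrightarrow{d}N_d\big(0,\mathcal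 J_\gamma^{-1}\mathcal I_\gamma\mathcal J_\gamma^{-1}\big).$$ -/

import Mathlib

open MeasureTheory ProbabilityTheory Filter Topology
open scoped ENNReal

noncomputable section

namespace DPD

/-! ### Stationary ergodic sequences and martingale differences -/

/-- The two-sided sequence `Y` of random elements of `S` is strictly stationary and ergodic: its
law on the path space `ℤ → S` is invariant and ergodic under the shift. -/
def StationaryErgodic {Ω S : Type*} [MeasurableSpace Ω] [MeasurableSpace S]
    (P : Measure Ω) (Y : ℤ → Ω → S) : Prop :=
  (∀ t, Measurable (Y t)) ∧
    Ergodic (fun (y : ℤ → S) (t : ℤ) => y (t + 1)) (P.map (fun ω t => Y t ω))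

/-- The σ-algebra `F_t = σ(X_s : s ≤ t)`. -/
abbrev pastSigma {Ω : Type*} (X : ℤ → Ω → ℝ) (t : ℤ) : MeasurableSpace Ω :=
  ⨆ s : {s : ℤ // s ≤ t}, MeasurableSpace.comap (X s) inferInstance

/-- `{ξ_t, F_t : t ∈ ℤ}` is a martingale difference sequence (with adaptedness up to null sets). -/
def IsMartingaleDifference {Ω E : Type*} [MeasurableSpace Ω] [NormedAddCommGroup E]
    [NormedSpace ℝ E] [CompleteSpace E] (P : Measure Ω) (F : ℤ → MeasurableSpace Ω)
    (ξ : ℤ → Ω → E) : Prop :=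
  ∀ t, AEStronglyMeasurable[F t] (ξ t) P ∧ Integrable (ξ t) P ∧
    P[ξ t | F (t - 1)] =ᵐ[P] 0

/-! ### The conditionally heteroscedastic model -/

/-- The model `X_t = σ_t(θ₀) ε_t`: the `ε_t` are i.i.d. with density `f`, mean zero and unit
variance, `ε_t` is independent of `F_{t-1} = σ(X_s : s ≤ t-1)`, and for every parameter `θ ∈ Θ`
the volatility `σ_t(θ)` is positive and `F_{t-1}`-measurable; `X` is strictly stationary and
ergodic. -/
structure IsHetModel {Ω : Type*} [MeasurableSpace Ω] {d : ℕ} (P : Measure Ω)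
    (Θ : Set (EuclideanSpace ℝ (Fin d))) (θ₀ : EuclideanSpace ℝ (Fin d)) (f : ℝ → ℝ)
    (ε X : ℤ → Ω → ℝ) (σ : ℤ → EuclideanSpace ℝ (Fin d) → Ω → ℝ) : Prop where
  measurable_density : Measurable f
  density_nonneg : ∀ x, 0 ≤ f x
  measurable_innovation : ∀ t, Measurable (ε t)
  innovation_law : ∀ t, P.map (ε t) = volume.withDensity (fun x => ENNReal.ofReal (f x))
  innovation_memLp : ∀ t, MemLp (ε t) 2 P
  innovation_mean : ∀ t, ∫ ω, ε t ω ∂P = 0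
  innovation_variance : ∀ t, ∫ ω, (ε t ω) ^ 2 ∂P = 1
  innovation_indep : iIndepFun ε P
  measurable_obs : ∀ t, Measurable (X t)
  innovation_indep_past : ∀ t,
    Indep (MeasurableSpace.comap (ε t) inferInstance) (pastSigma X (t - 1)) P
  volatility_pos : ∀ t, ∀ θ ∈ Θ, ∀ ω, 0 < σ t θ ω
  volatility_measurable : ∀ t, ∀ θ ∈ Θ, Measurable[pastSigma X (t - 1)] (σ t θ)
  model_eq : ∀ t, ∀ᵐ ω ∂P, X t ω = σ t θ₀ ω * ε t ω
  stationaryErgodic : StationaryErgodic P X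

/-! ### The density power divergence criterion -/

/-- The density `x ↦ s⁻¹ f (x / s)` of `s ε` when `ε` has density `f`. -/
def scaledDensity (f : ℝ → ℝ) (s x : ℝ) : ℝ := 1 / s * f (x / s)

/-- The contribution of an observation `x` with conditional scale `s` to the criterion. -/
def dpdTerm (γ : ℝ) (f : ℝ → ℝ) (s x : ℝ) : ℝ :=
  if γ = 0 then Real.log (scaledDensity f s x)
  else 1 / γ * scaledDensity f s x ^ γ
    - 1 / (1 + γ) * ∫ y, scaledDensity f s y ^ (1 + γ)

/-- The summand `q_t(θ)` of the criterion, from the volatilities `σ` and observations `X`. -/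
def qTerm {Ω T V : Type*} (γ : ℝ) (f : ℝ → ℝ) (X : T → Ω → ℝ) (σ : T → V → Ω → ℝ)
    (t : T) (θ : V) (ω : Ω) : ℝ :=
  dpdTerm γ f (σ t θ ω) (X t ω)

/-- The feasible criterion `∑_{t=1}^n q̃_t(θ)`. -/
def criterion {Ω V : Type*} (qt : ℕ → V → Ω → ℝ) (n : ℕ) (θ : V) (ω : Ω) : ℝ :=
  ∑ t ∈ Finset.Icc 1 n, qt t θ ω

/-- `θhat n` is, for every sample size `n ≥ 1`, a (measurable) maximizer of the criterion over `Θ`: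
the minimum density power divergence estimator. -/
def IsMDPDE {Ω : Type*} [MeasurableSpace Ω] {d : ℕ} (P : Measure Ω)
    (Θ : Set (EuclideanSpace ℝ (Fin d))) (qt : ℕ → EuclideanSpace ℝ (Fin d) → Ω → ℝ)
    (θhat : ℕ → Ω → EuclideanSpace ℝ (Fin d)) : Prop :=
  (∀ n, AEMeasurable (θhat n) P) ∧
    ∀ n, 1 ≤ n → ∀ᵐ ω ∂P, θhat n ω ∈ Θ ∧ IsMaxOn (fun θ => criterion qt n θ ω) Θ (θhat n ω)

/-- The criterion is well defined: the integral in it is finite and, for `γ = 0`, the logarithms are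
taken of positive numbers almost surely. -/
def WellDefined {Ω : Type*} [MeasurableSpace Ω] {d : ℕ} (P : Measure Ω) (γ : ℝ)
    (Θ : Set (EuclideanSpace ℝ (Fin d))) (f : ℝ → ℝ) (X : ℤ → Ω → ℝ)
    (σ : ℤ → EuclideanSpace ℝ (Fin d) → Ω → ℝ)
    (σt : ℕ → EuclideanSpace ℝ (Fin d) → Ω → ℝ) : Prop :=
  Integrable (fun x => f x ^ (1 + γ)) ∧
    (γ = 0 → ∀ᵐ ω ∂P, ∀ θ ∈ Θ,
      (∀ t, 0 < scaledDensity f (σ t θ ω) (X t ω)) ∧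
      (∀ t, 1 ≤ t → 0 < scaledDensity f (σt t θ ω) (X t ω)))

/-! ### Derivatives in the parameter, and their `ℓ¹` norms -/

section derivatives

variable {d : ℕ}

/-- The `ℓ¹` norm of a vector. -/
def vecL1 (v : EuclideanSpace ℝ (Fin d)) : ℝ := ∑ i, |v i|

/-- The entrywise `ℓ¹` norm of a matrix. -/
def matL1 (M : Matrix (Fin d) (Fin d) ℝ) : ℝ := ∑ i, ∑ j, |M i j|

/-- The matrix of second partial derivatives `∂² g / ∂θ_i ∂θ_j` at `θ`. -/
def hessian (g : EuclideanSpace ℝ (Fin d) → ℝ) (θ : EuclideanSpace ℝ (Fin d)) :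
    Matrix (Fin d) (Fin d) ℝ :=
  fun i j => fderiv ℝ (fun η => fderiv ℝ g η (EuclideanSpace.single j 1)) θ
    (EuclideanSpace.single i 1)

end derivatives

/-! ### The assumptions -/

section assumptions

variable {Ω : Type*} [MeasurableSpace Ω] {d : ℕ} (P : Measure Ω)
  (Θ : Set (EuclideanSpace ℝ (Fin d))) (θ₀ : EuclideanSpace ℝ (Fin d)) (X : ℤ → Ω → ℝ)
  (q : ℤ → EuclideanSpace ℝ (Fin d) → Ω → ℝ) (qt : ℕ → EuclideanSpace ℝ (Fin d) → Ω → ℝ)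

/-- `q_t` is almost surely continuous on `Θ`, and the sequence of random functions
`t ↦ (q_t(θ))_{θ ∈ Θ}` is strictly stationary and ergodic. -/
def A1 : Prop :=
  (∀ t, ∀ᵐ ω ∂P, ContinuousOn (fun θ => q t θ ω) Θ) ∧
    StationaryErgodic P (fun t ω (θ : Θ) => q t θ ω)

/-- `E sup_Θ |q_t| < ∞` and `n⁻¹ ∑_{t=1}^n sup_Θ |q_t - q̃_t| → 0` almost surely. -/
def A2 : Prop :=
  (∀ t, ∫⁻ ω, ⨆ θ ∈ Θ, ENNReal.ofReal |q t θ ω| ∂P < ∞) ∧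
    ∀ᵐ ω ∂P, Tendsto (fun n : ℕ => (∑ t ∈ Finset.Icc 1 n,
      ⨆ θ ∈ Θ, ENNReal.ofReal |q t θ ω - qt t θ ω|) / (n : ℝ≥0∞)) atTop (𝓝 0)

/-- `{∂q_t(θ₀), F_t}` is a martingale difference sequence. -/
def A3 : Prop :=
  IsMartingaleDifference P (pastSigma X) (fun t ω => gradient (fun θ => q t θ ω) θ₀)

/-- `n^{-1/2} ∑_{t=1}^n ‖∂q_t(θ₀) - ∂q̃_t(θ₀)‖ → 0` almost surely. -/
def A4 : Prop :=
  ∀ᵐ ω ∂P, Tendsto (fun n : ℕ => 1 / √(n : ℝ) * ∑ t ∈ Finset.Icc 1 n,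
    vecL1 (gradient (fun θ => q t θ ω) θ₀ - gradient (fun θ => qt t θ ω) θ₀)) atTop (𝓝 0)

/-- `n⁻¹ ∑_{t=1}^n sup_{N₁} ‖∂²q_t - ∂²q̃_t‖ → 0` almost surely, for a neighbourhood `N₁`. -/
def A5 : Prop :=
  ∃ N₁ ∈ 𝓝 θ₀, ∀ᵐ ω ∂P, Tendsto (fun n : ℕ => (∑ t ∈ Finset.Icc 1 n,
    ⨆ θ ∈ N₁, ENNReal.ofReal
      (matL1 (hessian (fun η => q t η ω) θ - hessian (fun η => qt t η ω) θ))) / (n : ℝ≥0∞))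
    atTop (𝓝 0)

/-- `E sup_{N₂} ‖∂²q_t‖ < ∞` for a neighbourhood `N₂` of `θ₀`. -/
def A6 : Prop :=
  ∃ N₂ ∈ 𝓝 θ₀, ∀ t, ∫⁻ ω, ⨆ θ ∈ N₂, ENNReal.ofReal (matL1 (hessian (fun η => q t η ω) θ)) ∂P < ∞

/-- `J = -E ∂²q_t(θ₀)`; it does not depend on `t` under stationarity, so `t = 0` is taken. -/
def matJ : Matrix (Fin d) (Fin d) ℝ :=
  fun i j => -∫ ω, hessian (fun η => q 0 η ω) θ₀ i j ∂P

/-- `I = E ∂q_t(θ₀) ∂q_t(θ₀)'`; again `t = 0` is taken. -/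
def matI : Matrix (Fin d) (Fin d) ℝ :=
  fun i j => ∫ ω, gradient (fun η => q 0 η ω) θ₀ i * gradient (fun η => q 0 η ω) θ₀ j ∂P

/-- The matrices `J` and `I` exist, and `J` is positive definite. -/
def A7 : Prop :=
  (∀ i j, Integrable (fun ω => hessian (fun η => q 0 η ω) θ₀ i j) P) ∧
    (∀ i j, Integrable (fun ω =>
      gradient (fun η => q 0 η ω) θ₀ i * gradient (fun η => q 0 η ω) θ₀ j) P) ∧
    (matJ P θ₀ q).PosDef

/-- On a neighbourhood of `θ₀`, almost surely all `q_t` and `q̃_t` are twice continuously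
differentiable, so that the derivatives in the assumptions make sense. -/
def TwiceDifferentiable : Prop :=
  ∃ N ∈ 𝓝 θ₀, ∀ᵐ ω ∂P, ∀ θ ∈ N,
    (∀ t, ContDiffAt ℝ 2 (fun η => q t η ω) θ) ∧
      ∀ t, 1 ≤ t → ContDiffAt ℝ 2 (fun η => qt t η ω) θ

end assumptions

end DPD

end

/-! Consistency is Wald's argument. Given the past, the expected gain of the true scale over another
scale is the integral of a pointwise divergence, nonnegative and zero only where the two scaled
densities agree. Comparing second moments, unit variance then forces the scales to agree, and
identifiability makes `θ₀` the unique maximizer of the expected criterion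
(`integral_criterionTerm_lt`). An ergodic law of large numbers, uniform near each point
(`exists_ball_average_sub_le`), and compactness then keep the estimator out of the complement of any
ball around `θ₀` (`tendsto_mdpde`).

For normality, the feasible score vanishes at the estimator once this lies in the interior. The
Hessian is uniformly close to `-n J` near `θ₀`, so a mean value inequality gives `n J (θhat - θ₀)` =
score at `θ₀` + `o(n ‖θhat - θ₀‖)`. By A4 the feasible score may be replaced by the martingale
score, which is asymptotically Gaussian, and Slutsky's theorem concludes.

Two tools are proved from scratch. The ergodic theorem comes from Garsia's maximal function. It
applies to gradients and Hessians because, as limits of difference quotients, they are almost surely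
fixed measurable functions of the path `θ ↦ q_t(θ)` at one time (`IsFactor`). The martingale central
limit theorem follows McLeish: `exp (i ∑ x_k)` is compared with `∏ (1 + i x_k)`, which has mean one
by the martingale property, while the ratio tends to `exp (-v / 2)`. Stopping the product bounds it
in `L²`, so that the limit passes under the expectation. -/

namespace DPD

/-! ### The pointwise ergodic theorem -/

section Birkhoff

variable {α : Type*} {mα : MeasurableSpace α} {μ : Measure α} {T : α → α} {g : α → ℝ}

/-- The running maximum of the Birkhoff sums of `g`, starting from `0`. -/
def birkhoffMax (T : α → α) (g : α → ℝ) : ℕ → α → ℝ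
  | 0, _ => 0
  | n + 1, x => max 0 (g x + birkhoffMax T g n (T x))

lemma birkhoffMax_nonneg (n : ℕ) (x : α) : 0 ≤ birkhoffMax T g n x := by
  cases n with
  | zero => simp [birkhoffMax]
  | succ n => exact le_max_left _ _

lemma birkhoffSum_le_birkhoffMax (n : ℕ) (x : α) : birkhoffSum T g n x ≤ birkhoffMax T g n x := by
  induction n generalizing x with
  | zero => simp [birkhoffMax]
  | succ n ih =>
    rw [birkhoffSum_succ']
    exact le_max_of_le_right (by simpa using ih (T x))

lemma birkhoffMax_monotone (x : α) : Monotone (fun n => birkhoffMax T g n x) := by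
  refine monotone_nat_of_le_succ fun n => ?_
  induction n generalizing x with
  | zero => exact birkhoffMax_nonneg _ _
  | succ n ih =>
    have := ih (T x)
    simp only [birkhoffMax] at this ⊢
    gcongr

lemma measurable_birkhoffMax (hT : Measurable T) (hg : Measurable g) (n : ℕ) :
    Measurable (birkhoffMax T g n) := by
  induction n with
  | zero => exact measurable_const
  | succ n ih => exact measurable_const.max (hg.add (ih.comp hT))

lemma integrable_birkhoffMax [IsFiniteMeasure μ] (hT : MeasurePreserving T μ μ)
    (hg : Integrable g μ) (n : ℕ) : Integrable (birkhoffMax T g n) μ := by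
  induction n with
  | zero => exact integrable_zero _ _ _
  | succ n ih => exact (integrable_const (0 : ℝ)).sup (hg.add (hT.integrable_comp_of_integrable ih))

/-- For an ergodic map the Birkhoff sums of a function with negative mean are bounded above. -/
lemma bddAbove_birkhoffMax [IsProbabilityMeasure μ] (hT : Ergodic T μ) (hgm : Measurable g)
    (hg : Integrable g μ) (hneg : ∫ x, g x ∂μ < 0) :
    ∀ᵐ x ∂μ, ∃ C, ∀ n, birkhoffMax T g n x ≤ C := by
  set B : Set α := {x | ∀ k : ℕ, ∃ n, (k : ℝ) < birkhoffMax T g n x} with hB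
  -- The set where the maxima are unbounded is invariant, hence null or of full measure. Full
  -- measure would force a nonnegative mean.
  have hmeas := measurable_birkhoffMax (g := g) hT.measurable hgm
  have hBm : MeasurableSet B := by
    simp only [hB, Set.ofPred_forall, Set.ofPred_exists]
    exact .iInter fun k => .iUnion fun n => measurableSet_lt measurable_const (hmeas n)
  have hBT : T ⁻¹' B = B := by
    ext x
    simp only [hB, Set.mem_preimage, Set.mem_ofPred_eq]
    constructor
    · intro h k
      obtain ⟨m, hm⟩ := exists_nat_gt (k - g x)
      obtain ⟨n, hn⟩ := h m
      refine ⟨n + 1, lt_max_of_lt_right ?_⟩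
      linarith
    · intro h k
      obtain ⟨m, hm⟩ := exists_nat_gt (k + |g x|)
      obtain ⟨n, hn⟩ := h m
      have hk : (0 : ℝ) ≤ k := Nat.cast_nonneg k
      cases n with
      | zero => simp only [birkhoffMax] at hn; linarith [abs_nonneg (g x)]
      | succ n =>
        refine ⟨n, ?_⟩
        simp only [birkhoffMax, lt_max_iff] at hn
        rcases hn with hn | hn
        · linarith [abs_nonneg (g x)]
        · linarith [le_abs_self (g x)]
  have hcompl : ∀ x ∉ B, ∃ C, ∀ n, birkhoffMax T g n x ≤ C := by
    intro x hx
    simp only [hB, Set.mem_ofPred_eq, not_forall, not_exists, not_lt] at hx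
    obtain ⟨k, hk⟩ := hx
    exact ⟨k, hk⟩
  rcases hT.toPreErgodic.ae_mem_or_ae_notMem hBm hBT with h | h
  · exfalso
    have hint := integrable_birkhoffMax hT.toMeasurePreserving hg
    -- The difference equals `max (-M_n ∘ T) g`, writing `M_n` for `birkhoffMax T g n`. It is
    -- dominated by `|g|`, and equals `g` as soon as `M_n ∘ T` exceeds `-g`, which happens
    -- eventually on `B`.
    have hlim : Tendsto (fun n => ∫ x, birkhoffMax T g (n + 1) x - birkhoffMax T g n (T x) ∂μ)
        atTop (𝓝 (∫ x, g x ∂μ)) := by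
      refine tendsto_integral_of_dominated_convergence (fun x => |g x|)
        (fun n => ((hmeas (n + 1)).sub ((hmeas n).comp hT.measurable)).aestronglyMeasurable)
        hg.abs (fun n => ae_of_all _ fun x => ?_) ?_
      · have h0 := birkhoffMax_nonneg (T := T) (g := g) n (T x)
        simp only [birkhoffMax, Real.norm_eq_abs]
        rcases max_cases 0 (g x + birkhoffMax T g n (T x)) with ⟨h1, h2⟩ | ⟨h1, h2⟩ <;> rw [h1]
        · rw [zero_sub, abs_neg, abs_of_nonneg h0, abs_of_nonpos (by linarith)]
          linarith
        · rw [add_sub_cancel_right]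
      · filter_upwards [h] with x hx
        rw [← hBT] at hx
        obtain ⟨m, hm⟩ := exists_nat_gt (-g x)
        obtain ⟨n₀, hn₀⟩ := hx m
        refine tendsto_const_nhds.congr' ?_
        filter_upwards [eventually_ge_atTop n₀] with n hn
        have := birkhoffMax_monotone (g := g) (T := T) (T x) hn
        simp only at this
        simp only [birkhoffMax]
        rw [max_eq_right (by linarith), add_sub_cancel_right]
    -- By invariance the integral of the difference is `∫ M_{n+1} - ∫ M_n`, which is nonnegative by
    -- monotonicity, so the limit `∫ g` cannot be negative.
    refine absurd (ge_of_tendsto' hlim fun n => ?_) (not_le.mpr hneg)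
    have hc := (hT.toMeasurePreserving.integrable_comp_of_integrable (hint n))
    have heq : ∫ x, birkhoffMax T g n (T x) ∂μ = ∫ x, birkhoffMax T g n x ∂μ := by
      conv_rhs => rw [← hT.map_eq]
      rw [integral_map hT.measurable.aemeasurable (hmeas n).aestronglyMeasurable]
    have hsub := integral_sub (hint (n + 1)) hc
    simp only [Function.comp_apply] at hsub
    rw [hsub, heq, sub_nonneg]
    exact integral_mono (hint n) (hint (n + 1)) fun x => birkhoffMax_monotone x n.le_succ
  · exact h.mono hcompl

/-- After subtracting a constant `b` strictly between the mean and `c`, the sums are bounded above,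
so division by `n` leaves at most `b` plus a vanishing term. -/
lemma eventually_birkhoffAverage_le [IsProbabilityMeasure μ] (hT : Ergodic T μ)
    (hgm : Measurable g) (hg : Integrable g μ) {c : ℝ} (hc : ∫ x, g x ∂μ < c) :
    ∀ᵐ x ∂μ, ∀ᶠ n : ℕ in atTop, birkhoffSum T g n x / n ≤ c := by
  obtain ⟨b, hb, hbc⟩ := exists_between hc
  have hneg : ∫ x, (g x - b) ∂μ < 0 := by
    rw [integral_sub hg (integrable_const _)]
    simpa using hb
  filter_upwards [bddAbove_birkhoffMax (g := fun x => g x - b) hT (hgm.sub_const b)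
    (hg.sub (integrable_const b)) hneg] with x hx
  obtain ⟨C, hC⟩ := hx
  have h1 : Tendsto (fun n : ℕ => C / (n : ℝ)) atTop (𝓝 0) :=
    tendsto_const_div_atTop_nhds_zero_nat C
  filter_upwards [h1.eventually_lt_const (sub_pos.mpr hbc), eventually_gt_atTop 0] with n hn hn0
  have hn' : (0 : ℝ) < n := by exact_mod_cast hn0
  have h2 := (birkhoffSum_le_birkhoffMax (g := fun x => g x - b) (T := T) n x).trans (hC n)
  have h3 : birkhoffSum T (fun x => g x - b) n x = birkhoffSum T g n x - n * b := by
    simp [birkhoffSum, Finset.sum_sub_distrib]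
  rw [h3] at h2
  rw [div_le_iff₀ hn']
  rw [div_lt_iff₀ hn'] at hn
  linarith

/-- **Birkhoff's pointwise ergodic theorem** for an ergodic map. -/
theorem tendsto_birkhoffSum_div [IsProbabilityMeasure μ] (hT : Ergodic T μ)
    (hgm : Measurable g) (hg : Integrable g μ) :
    ∀ᵐ x ∂μ, Tendsto (fun n : ℕ => birkhoffSum T g n x / n) atTop (𝓝 (∫ x, g x ∂μ)) := by
  have hpos : ∀ k : ℕ, (0 : ℝ) < 1 / ((k : ℝ) + 1) := fun k => Nat.one_div_pos_of_nat
  have hup : ∀ k : ℕ, ∀ᵐ x ∂μ, ∀ᶠ n : ℕ in atTop,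
      birkhoffSum T g n x / n ≤ ∫ x, g x ∂μ + 1 / ((k : ℝ) + 1) := fun k =>
    eventually_birkhoffAverage_le hT hgm hg (by linarith [hpos k])
  have hlo : ∀ k : ℕ, ∀ᵐ x ∂μ, ∀ᶠ n : ℕ in atTop,
      birkhoffSum T (-g) n x / n ≤ ∫ x, (-g) x ∂μ + 1 / ((k : ℝ) + 1) := fun k =>
    eventually_birkhoffAverage_le hT hgm.neg hg.neg (by linarith [hpos k])
  filter_upwards [ae_all_iff.mpr hup, ae_all_iff.mpr hlo] with x h1 h2
  rw [Metric.tendsto_nhds]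
  intro ε hε
  obtain ⟨k, hk⟩ := exists_nat_one_div_lt hε
  filter_upwards [h1 k, h2 k] with n hn1 hn2
  rw [birkhoffSum_neg, neg_div] at hn2
  simp only [Pi.neg_apply, integral_neg] at hn2
  rw [Real.dist_eq, abs_lt]
  constructor <;> linarith

end Birkhoff

/-! ### Factors of stationary ergodic sequences -/

section Factor

variable {Ω S : Type*} [MeasurableSpace Ω] [MeasurableSpace S] {P : Measure Ω} {Y : ℤ → Ω → S}

/-- The sequence `Z` is obtained from `Y` by applying, up to null sets, one measurable function
to each of its terms. -/
def IsFactor {β : Type*} [MeasurableSpace β] (P : Measure Ω) (Y : ℤ → Ω → S) (Z : ℤ → Ω → β) :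
    Prop :=
  ∃ g : S → β, Measurable g ∧ ∀ t, Z t =ᵐ[P] fun ω => g (Y t ω)

lemma measurable_path (hY : StationaryErgodic P Y) : Measurable (fun ω (t : ℤ) => Y t ω) :=
  measurable_pi_lambda _ hY.1

lemma StationaryErgodic.identDistrib (hY : StationaryErgodic P Y) (t : ℤ) :
    IdentDistrib (Y t) (Y 0) P P := by
  have hp := measurable_path hY
  have hstep : ∀ t, P.map (Y (t + 1)) = P.map (Y t) := fun t => by
    have h := hY.2.map_eq
    have h2 := congrArg (Measure.map (fun y : ℤ → S => y t)) h
    rw [Measure.map_map (measurable_pi_apply t) hY.2.measurable,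
      Measure.map_map ((measurable_pi_apply t).comp hY.2.measurable) hp,
      Measure.map_map (measurable_pi_apply t) hp] at h2
    exact h2
  refine ⟨(hY.1 t).aemeasurable, (hY.1 0).aemeasurable, ?_⟩
  induction t using Int.induction_on with
  | zero => rfl
  | succ n ih => rw [hstep, ih]
  | pred n ih => rw [← ih, ← hstep (-(n : ℤ) - 1), sub_add_cancel]

namespace IsFactor

variable {β γ : Type*} [MeasurableSpace β] [MeasurableSpace γ]

lemma aemeasurable {Z : ℤ → Ω → β} (hY : StationaryErgodic P Y) (hZ : IsFactor P Y Z) (t : ℤ) :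
    AEMeasurable (Z t) P := by
  obtain ⟨g, hg, h⟩ := hZ
  exact ⟨_, hg.comp (hY.1 t), h t⟩

lemma identDistrib {Z : ℤ → Ω → β} (hY : StationaryErgodic P Y) (hZ : IsFactor P Y Z) (t : ℤ) :
    IdentDistrib (Z t) (Z 0) P P := by
  have hm := hZ.aemeasurable hY
  obtain ⟨g, hg, h⟩ := hZ
  have h1 := (hY.identDistrib t).comp hg
  refine ⟨hm t, hm 0, ?_⟩
  rw [Measure.map_congr (h t), Measure.map_congr (h 0)]
  exact h1.map_eq

lemma comp {Z : ℤ → Ω → β} (hZ : IsFactor P Y Z) {φ : β → γ} (hφ : Measurable φ) :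
    IsFactor P Y (fun t ω => φ (Z t ω)) := by
  obtain ⟨g, hg, h⟩ := hZ
  refine ⟨fun s => φ (g s), hφ.comp hg, fun t => ?_⟩
  filter_upwards [h t] with ω hω
  rw [hω]

lemma pi {ι : Type*} [Countable ι] {Z : ι → ℤ → Ω → β} (hZ : ∀ i, IsFactor P Y (Z i)) :
    IsFactor P Y (fun t ω i => Z i t ω) := by
  choose g hg h using hZ
  refine ⟨fun s i => g i s, measurable_pi_lambda _ hg, fun t => ?_⟩
  filter_upwards [ae_all_iff.mpr fun i => h i t] with ω hω
  ext i
  exact hω i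

lemma congr {Z Z' : ℤ → Ω → β} (hZ : IsFactor P Y Z) (h : ∀ t, Z' t =ᵐ[P] Z t) :
    IsFactor P Y Z' := by
  obtain ⟨g, hg, hgZ⟩ := hZ
  exact ⟨g, hg, fun t => (h t).trans (hgZ t)⟩

lemma prodMk {Z : ℤ → Ω → β} {Z' : ℤ → Ω → γ} (hZ : IsFactor P Y Z) (hZ' : IsFactor P Y Z') :
    IsFactor P Y (fun t ω => (Z t ω, Z' t ω)) := by
  obtain ⟨g, hg, h⟩ := hZ
  obtain ⟨g', hg', h'⟩ := hZ'
  refine ⟨fun s => (g s, g' s), hg.prodMk hg', fun t => ?_⟩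
  filter_upwards [h t, h' t] with ω h1 h2
  rw [h1, h2]

/-- The `limsup` is measurable on all of `ℕ → ℝ`, so it serves as one common function for every `t`
even where convergence fails. -/
lemma of_tendsto {Z : ℕ → ℤ → Ω → ℝ} {Z' : ℤ → Ω → ℝ} (hZ : ∀ k, IsFactor P Y (Z k))
    (h : ∀ t, ∀ᵐ ω ∂P, Tendsto (fun k => Z k t ω) atTop (𝓝 (Z' t ω))) : IsFactor P Y Z' := by
  have h1 : Measurable fun z : ℕ → ℝ => limsup z atTop :=
    Measurable.limsup fun k => measurable_pi_apply k
  refine ((IsFactor.pi hZ).comp h1).congr fun t => ?_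
  filter_upwards [h t] with ω hω
  exact hω.limsup_eq.symm

lemma integrable {Z : ℤ → Ω → ℝ} (hY : StationaryErgodic P Y) (hZ : IsFactor P Y Z)
    (h0 : Integrable (Z 0) P) (t : ℤ) : Integrable (Z t) P :=
  (hZ.identDistrib hY t).integrable_iff.mpr h0

lemma integral_eq {Z : ℤ → Ω → ℝ} (hY : StationaryErgodic P Y) (hZ : IsFactor P Y Z) (t : ℤ) :
    ∫ ω, Z t ω ∂P = ∫ ω, Z 0 ω ∂P :=
  (hZ.identDistrib hY t).integral_eq

lemma lintegral_eq {Z : ℤ → Ω → ℝ≥0∞} (hY : StationaryErgodic P Y) (hZ : IsFactor P Y Z) (t : ℤ) :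
    ∫⁻ ω, Z t ω ∂P = ∫⁻ ω, Z 0 ω ∂P :=
  (hZ.identDistrib hY t).lintegral_eq

/-- The strong law of large numbers for integrable factors of a stationary ergodic sequence. -/
theorem tendsto_average [IsProbabilityMeasure P] {Z : ℤ → Ω → ℝ} (hY : StationaryErgodic P Y)
    (hZ : IsFactor P Y Z) (h0 : Integrable (Z 0) P) :
    ∀ᵐ ω ∂P, Tendsto (fun n : ℕ => (∑ t ∈ Finset.Icc 1 n, Z t ω) / (n : ℝ)) atTop
      (𝓝 (∫ ω, Z 0 ω ∂P)) := by
  have hp := measurable_path hY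
  have hZ1 := hZ.integrable hY h0 1
  have hI1 := hZ.integral_eq hY 1
  obtain ⟨g, hg, h⟩ := hZ
  have hprob : IsProbabilityMeasure (P.map fun ω (t : ℤ) => Y t ω) :=
    Measure.isProbabilityMeasure_map hp.aemeasurable
  -- Coordinate `1` is used because the averages start at `t = 1`: the `k`-th shift then reads time
  -- `k + 1`.
  have hm : Measurable fun y : ℤ → S => g (y 1) := hg.comp (measurable_pi_apply 1)
  have hi : Integrable (fun y : ℤ → S => g (y 1)) (P.map fun ω (t : ℤ) => Y t ω) := by
    rw [integrable_map_measure hm.aestronglyMeasurable hp.aemeasurable]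
    exact hZ1.congr (h 1)
  have hB := ae_of_ae_map hp.aemeasurable (tendsto_birkhoffSum_div hY.2 hm hi)
  rw [integral_map hp.aemeasurable hm.aestronglyMeasurable, ← integral_congr_ae (h 1), hI1] at hB
  filter_upwards [hB, ae_all_iff.mpr h] with ω h1 h2
  refine h1.congr fun n => ?_
  congr 1
  have hiter : ∀ (k : ℕ) (y : ℤ → S), (fun (y : ℤ → S) (t : ℤ) => y (t + 1))^[k] y
      = fun t => y (t + k) := by
    intro k
    induction k with
    | zero => intro y; simp
    | succ k ih =>
      intro y
      rw [Function.iterate_succ_apply, ih]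
      ext t
      push_cast
      ring_nf
  have hs : ∑ t ∈ Finset.Icc 1 n, Z t ω = ∑ k ∈ Finset.range n, Z ((k + 1 : ℕ) : ℤ) ω := by
    rw [Finset.range_eq_Ico, Finset.sum_Ico_add' (fun t : ℕ => Z t ω) 0 n 1]
    rfl
  rw [birkhoffSum, hs]
  exact Finset.sum_congr rfl fun k _ => by rw [hiter, h2]; push_cast; ring_nf

end IsFactor

end Factor

/-! ### A local uniform law of large numbers -/

section LocalUniform

variable {Ω S V : Type*} [MeasurableSpace Ω] [MeasurableSpace S] {P : Measure Ω} {Y : ℤ → Ω → S}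

lemma IsFactor.iSup {ι : Type*} [Countable ι] {Z : ι → ℤ → Ω → ℝ≥0∞}
    (hZ : ∀ i, IsFactor P Y (Z i)) : IsFactor P Y (fun t ω => ⨆ i, Z i t ω) :=
  (IsFactor.pi hZ).comp (φ := fun z : ι → ℝ≥0∞ => ⨆ i, z i)
    (Measurable.iSup fun i => measurable_pi_apply i)

lemma integrable_of_lintegral_iSup_lt_top {K : Set V} {z : V → Ω → ℝ} {θ : V} (hθ : θ ∈ K)
    (hm : AEMeasurable (z θ) P)
    (hsup : ∫⁻ ω, ⨆ θ ∈ K, ENNReal.ofReal |z θ ω| ∂P < ∞) : Integrable (z θ) P := by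
  refine ⟨hm.aestronglyMeasurable, ?_⟩
  refine lt_of_le_of_lt (lintegral_mono fun ω => ?_) hsup
  rw [Real.enorm_eq_ofReal_abs]
  exact le_iSup₂_of_le θ hθ le_rfl

/-- Near a point, the averages of a stationary ergodic sequence of continuous random functions with
integrable supremum are eventually uniformly close to the mean at the point. -/
theorem exists_ball_average_sub_le [IsProbabilityMeasure P] [PseudoMetricSpace V]
    [SecondCountableTopology V] (hY : StationaryErgodic P Y) {K : Set V} {Z : ℤ → V → Ω → ℝ}
    (hfac : ∀ θ ∈ K, IsFactor P Y (fun t => Z t θ))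
    (hcont : ∀ t, ∀ᵐ ω ∂P, ContinuousOn (fun θ => Z t θ ω) K)
    (hsup : ∫⁻ ω, ⨆ θ ∈ K, ENNReal.ofReal |Z 0 θ ω| ∂P < ∞)
    {θ₁ : V} (hθ₁ : θ₁ ∈ K) {ε : ℝ} (hε : 0 < ε) :
    ∃ r > 0, ∀ᵐ ω ∂P, ∀ᶠ n : ℕ in atTop, ∀ θ ∈ K ∩ Metric.ball θ₁ r,
      |(∑ t ∈ Finset.Icc 1 n, Z t θ ω) / (n : ℝ) - ∫ ω, Z 0 θ₁ ω ∂P| ≤ ε := by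
  -- A countable dense subset makes the local oscillation `W` measurable and a factor. Continuity on
  -- `K` and openness of the ball extend its bound to all of `K` inside the ball.
  obtain ⟨D, hDK, hDc, hD⟩ :=
    (TopologicalSpace.IsSeparable.of_separableSpace K).exists_countable_dense_subset
  set ρ : ℕ → ℝ := fun k => 1 / ((k : ℝ) + 1)
  have hρ : ∀ k, 0 < ρ k := fun k => Nat.one_div_pos_of_nat
  set W : ℕ → ℤ → Ω → ℝ≥0∞ := fun k t ω =>
    ⨆ θ : ↥(D ∩ Metric.ball θ₁ (ρ k)), ENNReal.ofReal |Z t θ ω - Z t θ₁ ω| with hW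
  have hWfac : ∀ k, IsFactor P Y (W k) := fun k => by
    have : Countable ↥(D ∩ Metric.ball θ₁ (ρ k)) := (hDc.mono Set.inter_subset_left).to_subtype
    exact IsFactor.iSup fun θ => ((hfac θ (hDK θ.2.1)).prodMk (hfac θ₁ hθ₁)).comp
      (φ := fun z : ℝ × ℝ => ENNReal.ofReal |z.1 - z.2|) (by fun_prop)
  have hWle : ∀ k t, ∀ᵐ ω ∂P, ∀ θ ∈ K ∩ Metric.ball θ₁ (ρ k),
      ENNReal.ofReal |Z t θ ω - Z t θ₁ ω| ≤ W k t ω := fun k t => by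
    filter_upwards [hcont t] with ω hω θ hθ
    have hcl : θ ∈ closure (D ∩ Metric.ball θ₁ (ρ k)) :=
      Set.inter_comm _ D ▸ Metric.isOpen_ball.inter_closure ⟨hθ.2, hD hθ.1⟩
    have hne : (𝓝[D ∩ Metric.ball θ₁ (ρ k)] θ).NeBot := mem_closure_iff_nhdsWithin_neBot.mp hcl
    have hc : Tendsto (fun η => ENNReal.ofReal |Z t η ω - Z t θ₁ ω|)
        (𝓝[D ∩ Metric.ball θ₁ (ρ k)] θ) (𝓝 (ENNReal.ofReal |Z t θ ω - Z t θ₁ ω|)) := by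
      refine (ENNReal.continuous_ofReal.tendsto _).comp ?_
      refine ((hω θ hθ.1).mono_left (nhdsWithin_mono _ ?_)).sub_const _ |>.abs
      exact Set.inter_subset_left.trans hDK
    refine le_of_tendsto hc ?_
    filter_upwards [self_mem_nhdsWithin] with η hη
    exact le_iSup (fun θ : ↥(D ∩ Metric.ball θ₁ (ρ k)) =>
      ENNReal.ofReal |Z t θ ω - Z t θ₁ ω|) ⟨η, hη⟩
  -- The oscillation vanishes as the radius shrinks, by continuity at `θ₁`, and is dominated by
  -- twice the integrable supremum.
  have hlim : Tendsto (fun k => ∫⁻ ω, W k 0 ω ∂P) atTop (𝓝 (∫⁻ _, 0 ∂P)) := by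
    refine tendsto_lintegral_of_dominated_convergence'
      (fun ω => 2 * ⨆ θ ∈ K, ENNReal.ofReal |Z 0 θ ω|)
      (fun k => (hWfac k).aemeasurable hY 0) (fun k => ae_of_all _ fun ω => ?_) ?_ ?_
    · refine iSup_le fun θ => ?_
      calc ENNReal.ofReal |Z 0 θ ω - Z 0 θ₁ ω|
          ≤ ENNReal.ofReal (|Z 0 θ ω| + |Z 0 θ₁ ω|) := ENNReal.ofReal_le_ofReal (abs_sub _ _)
        _ = ENNReal.ofReal |Z 0 θ ω| + ENNReal.ofReal |Z 0 θ₁ ω| :=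
            ENNReal.ofReal_add (abs_nonneg _) (abs_nonneg _)
        _ ≤ _ := by
            simp only [two_mul]
            exact add_le_add (le_iSup₂_of_le (θ : V) (hDK θ.2.1) le_rfl)
              (le_iSup₂_of_le θ₁ hθ₁ le_rfl)
    · rw [lintegral_const_mul' _ _ (by simp)]
      exact (ENNReal.mul_lt_top (by simp) hsup).ne
    · filter_upwards [hcont 0] with ω hω
      rw [ENNReal.tendsto_nhds_zero]
      intro δ hδ
      by_cases hδt : δ = ∞
      · simp [hδt]
      have hδ' : 0 < δ.toReal := ENNReal.toReal_pos hδ.ne' hδt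
      obtain ⟨r, hr, hrK⟩ := Metric.continuousWithinAt_iff.mp (hω θ₁ hθ₁) δ.toReal hδ'
      have hρ0 : Tendsto ρ atTop (𝓝 0) := tendsto_one_div_add_atTop_nhds_zero_nat
      filter_upwards [hρ0.eventually_lt_const hr] with k hk
      refine iSup_le fun θ => ?_
      rw [← ENNReal.ofReal_toReal hδt]
      refine ENNReal.ofReal_le_ofReal ?_
      have := hrK (hDK θ.2.1) ((Metric.mem_ball.mp θ.2.2).trans hk)
      rw [Real.dist_eq] at this
      exact this.le
  rw [lintegral_zero] at hlim
  -- One radius with mean oscillation below `ε / 2` suffices: the averages of `W` control the move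
  -- from `θ` to `θ₁`, and those of `Z` at `θ₁` use the other half.
  obtain ⟨k, hk⟩ := (hlim.eventually_lt_const (ENNReal.ofReal_pos.mpr (half_pos hε))).exists
  have hWfin : ∀ t, ∀ᵐ ω ∂P, W k t ω < ∞ := fun t =>
    ae_lt_top' ((hWfac k).aemeasurable hY t)
      (by rw [(hWfac k).lintegral_eq hY t]; exact (hk.trans ENNReal.ofReal_lt_top).ne)
  have hWr : IsFactor P Y (fun t ω => (W k t ω).toReal) := (hWfac k).comp ENNReal.measurable_toReal
  have hWi : Integrable (fun ω => (W k 0 ω).toReal) P :=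
    integrable_toReal_of_lintegral_ne_top ((hWfac k).aemeasurable hY 0)
      (hk.trans ENNReal.ofReal_lt_top).ne
  have hWI : ∫ ω, (W k 0 ω).toReal ∂P < ε / 2 := by
    rw [integral_toReal ((hWfac k).aemeasurable hY 0) (hWfin 0)]
    exact ENNReal.toReal_lt_of_lt_ofReal hk
  have hZi : Integrable (Z 0 θ₁) P :=
    integrable_of_lintegral_iSup_lt_top hθ₁ ((hfac θ₁ hθ₁).aemeasurable hY 0) hsup
  refine ⟨ρ k, hρ k, ?_⟩
  filter_upwards [hWr.tendsto_average hY hWi, (hfac θ₁ hθ₁).tendsto_average hY hZi,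
    ae_all_iff.mpr hWfin, ae_all_iff.mpr (hWle k)] with ω h1 h2 h3 h4
  have h2' := Metric.tendsto_nhds.mp h2 (ε / 2) (half_pos hε)
  filter_upwards [h1.eventually_lt_const hWI, h2'] with n hn1 hn2 θ hθ
  have hdiff : |(∑ t ∈ Finset.Icc 1 n, Z t θ ω) / (n : ℝ)
      - (∑ t ∈ Finset.Icc 1 n, Z t θ₁ ω) / (n : ℝ)|
      ≤ (∑ t ∈ Finset.Icc 1 n, (W k t ω).toReal) / (n : ℝ) := by
    rw [← sub_div, ← Finset.sum_sub_distrib, abs_div, Nat.abs_cast]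
    gcongr
    refine (Finset.abs_sum_le_sum_abs _ _).trans (Finset.sum_le_sum fun t _ => ?_)
    exact (ENNReal.ofReal_le_iff_le_toReal (h3 t).ne).mp (h4 t θ hθ)
  rw [Real.dist_eq] at hn2
  have := abs_sub_le ((∑ t ∈ Finset.Icc 1 n, Z t θ ω) / (n : ℝ))
    ((∑ t ∈ Finset.Icc 1 n, Z t θ₁ ω) / (n : ℝ)) (∫ ω, Z 0 θ₁ ω ∂P)
  linarith

end LocalUniform

/-! ### The central limit theorem for martingale differences -/

section MartingaleCLT

/-- The partial products of `1 + i x_k`, stopped once the sum of the squares exceeds `C`. -/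
noncomputable def stoppedProd (C : ℝ) (x : ℕ → ℝ) : ℕ → ℂ
  | 0 => 1
  | k + 1 => stoppedProd C x k *
      (1 + Complex.I * ((if ∑ s ∈ Finset.range k, x s ^ 2 ≤ C then x k else 0 : ℝ) : ℂ))

lemma norm_one_add_I_mul_sq (y : ℝ) : ‖(1 : ℂ) + Complex.I * (y : ℂ)‖ ^ 2 = 1 + y ^ 2 := by
  rw [Complex.sq_norm, Complex.normSq_apply]
  simp
  ring

lemma one_le_norm_one_add_I_mul (y : ℝ) : 1 ≤ ‖(1 : ℂ) + Complex.I * (y : ℂ)‖ := by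
  have := norm_one_add_I_mul_sq y
  nlinarith [norm_nonneg ((1 : ℂ) + Complex.I * (y : ℂ)), sq_nonneg y]

variable {C : ℝ} {x : ℕ → ℝ}

lemma one_le_norm_stoppedProd (k : ℕ) : 1 ≤ ‖stoppedProd C x k‖ := by
  induction k with
  | zero => simp [stoppedProd]
  | succ k ih =>
    rw [stoppedProd, norm_mul]
    exact one_le_mul_of_one_le_of_one_le ih (one_le_norm_one_add_I_mul _)

/-- Each squared factor is `1 + x_s ^ 2 ≤ exp (x_s ^ 2)`. -/
lemma norm_stoppedProd_sq_le_of_sum_le {k : ℕ} (h : ∑ s ∈ Finset.range k, x s ^ 2 ≤ C) :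
    ‖stoppedProd C x k‖ ^ 2 ≤ Real.exp C := by
  refine le_trans ?_ (Real.exp_le_exp.mpr h)
  induction k with
  | zero => simp [stoppedProd]
  | succ k ih =>
    rw [Finset.sum_range_succ] at h ⊢
    have hk : ∑ s ∈ Finset.range k, x s ^ 2 ≤ C := by nlinarith [sq_nonneg (x k)]
    rw [stoppedProd, if_pos hk, norm_mul, mul_pow, norm_one_add_I_mul_sq, Real.exp_add]
    have := Real.add_one_le_exp (x k ^ 2)
    exact mul_le_mul (ih hk) (by linarith) (by positivity) (Real.exp_pos _).le

/-- Only the factor that carries the sum past `C` escapes the exponential bound, and it costs `1 +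
x_s ^ 2`. With second moments `v` and scaling by `√n`, this bounds the product in `L²` uniformly in
`n`. -/
lemma norm_stoppedProd_sq_le (hC : 0 ≤ C) (k : ℕ) :
    ‖stoppedProd C x k‖ ^ 2 ≤ Real.exp C * (1 + ∑ s ∈ Finset.range k, x s ^ 2) := by
  induction k with
  | zero => simpa [stoppedProd] using Real.one_le_exp hC
  | succ k ih =>
    have he := Real.exp_pos C
    have hs : 0 ≤ ∑ s ∈ Finset.range k, x s ^ 2 := Finset.sum_nonneg fun _ _ => sq_nonneg _
    rw [Finset.sum_range_succ]
    by_cases hk : ∑ s ∈ Finset.range k, x s ^ 2 ≤ C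
    · rw [stoppedProd, if_pos hk, norm_mul, mul_pow, norm_one_add_I_mul_sq]
      refine mul_le_mul (norm_stoppedProd_sq_le_of_sum_le hk) (by linarith) (by positivity) he.le
    · rw [stoppedProd, if_neg hk]
      simp only [Complex.ofReal_zero, mul_zero, add_zero, mul_one]
      refine ih.trans (mul_le_mul_of_nonneg_left ?_ he.le)
      nlinarith [sq_nonneg (x k)]

lemma stoppedProd_eq_prod {n : ℕ} (h : ∑ s ∈ Finset.range n, x s ^ 2 ≤ C) :
    stoppedProd C x n = ∏ s ∈ Finset.range n, (1 + Complex.I * (x s : ℂ)) := by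
  induction n with
  | zero => simp [stoppedProd]
  | succ k ih =>
    rw [Finset.sum_range_succ] at h
    have hk : ∑ s ∈ Finset.range k, x s ^ 2 ≤ C := by nlinarith [sq_nonneg (x k)]
    rw [stoppedProd, if_pos hk, ih hk, Finset.prod_range_succ]

/-- Convergence of the averages of squares forces the terms to be uniformly `o(√n)`. -/
lemma eventually_forall_abs_le_of_tendsto_average {a : ℕ → ℝ} {v : ℝ}
    (h : Tendsto (fun n : ℕ => (∑ k ∈ Finset.range n, a k ^ 2) / (n : ℝ)) atTop (𝓝 v))
    {δ : ℝ} (hδ : 0 < δ) : ∀ᶠ n : ℕ in atTop, ∀ k < n, |a k / √(n : ℝ)| ≤ δ := by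
  have h1 : Tendsto (fun n : ℕ => a n ^ 2 / ((n : ℝ) + 1)) atTop (𝓝 0) := by
    have h2 := (tendsto_add_atTop_iff_nat 1).mpr h
    have h3 : Tendsto (fun n : ℕ => (n : ℝ) / ((n : ℝ) + 1)) atTop (𝓝 1) :=
      tendsto_natCast_div_add_atTop 1
    -- The last term is the average at `n + 1` minus `n / (n + 1)` times the average at `n`.
    have h4 := h2.sub (h.mul h3)
    rw [mul_one, sub_self] at h4
    refine h4.congr' ?_
    filter_upwards [eventually_gt_atTop 0] with n hn
    have : (n : ℝ) ≠ 0 := by exact_mod_cast hn.ne'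
    have h5 : (n : ℝ) + 1 ≠ 0 := by positivity
    rw [Finset.sum_range_succ]
    push_cast
    field_simp
    ring
  obtain ⟨K, hK⟩ := eventually_atTop.mp (h1.eventually_lt_const (show 0 < δ ^ 2 by positivity))
  -- The finitely many early terms are harmless because `δ ^ 2 * n` tends to infinity.
  have hfin : ∀ᶠ n : ℕ in atTop, ∀ k ∈ Finset.range K, a k ^ 2 ≤ δ ^ 2 * n := by
    rw [eventually_all_finset]
    intro k _
    have : Tendsto (fun n : ℕ => δ ^ 2 * (n : ℝ)) atTop atTop :=
      tendsto_natCast_atTop_atTop.const_mul_atTop (by positivity)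
    exact this.eventually_ge_atTop _
  filter_upwards [hfin, eventually_gt_atTop 0] with n hn hn0 k hk
  have hn' : (0 : ℝ) < n := by exact_mod_cast hn0
  have key : a k ^ 2 ≤ δ ^ 2 * n := by
    by_cases hkK : k < K
    · exact hn k (Finset.mem_range.mpr hkK)
    · have h6 := hK k (not_lt.mp hkK)
      rw [div_lt_iff₀ (by positivity)] at h6
      refine h6.le.trans ?_
      have : (k : ℝ) + 1 ≤ n := by exact_mod_cast hk
      gcongr
  rw [abs_div, abs_of_nonneg (Real.sqrt_nonneg _), div_le_iff₀ (Real.sqrt_pos.mpr hn')]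
  refine abs_le_of_sq_le_sq ?_ (by positivity)
  rwa [mul_pow, Real.sq_sqrt hn'.le]

/-- Second-order Taylor expansion of the logarithm at `i y`, where the quadratic term is real. The
remainder is at most `|y| ^ 3 / (3 (1 - |y|))`, and `(1 - |y|)⁻¹ ≤ 2`. -/
lemma norm_log_one_add_I_mul_sub_le {y : ℝ} (hy : |y| ≤ 1 / 2) :
    ‖Complex.I * (y : ℂ) - Complex.log (1 + Complex.I * (y : ℂ)) + (y : ℂ) ^ 2 / 2‖ ≤ |y| ^ 3 := by
  have hn : ‖Complex.I * (y : ℂ)‖ = |y| := by simp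
  have h := Complex.norm_log_sub_logTaylor_le 2 (z := Complex.I * (y : ℂ)) (by rw [hn]; linarith)
  have ht : Complex.logTaylor (2 + 1) (Complex.I * (y : ℂ))
      = Complex.I * (y : ℂ) + (y : ℂ) ^ 2 / 2 := by
    simp only [Complex.logTaylor_succ, Complex.logTaylor_zero, Pi.add_apply]
    norm_num
    rw [mul_pow, Complex.I_sq]
    ring
  rw [ht, hn, ← norm_neg] at h
  have e : Complex.I * (y : ℂ) - Complex.log (1 + Complex.I * (y : ℂ)) + (y : ℂ) ^ 2 / 2
      = -(Complex.log (1 + Complex.I * (y : ℂ)) - (Complex.I * (y : ℂ) + (y : ℂ) ^ 2 / 2)) := by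
    ring
  rw [e]
  refine h.trans ?_
  have h2 : (1 - |y|)⁻¹ ≤ 2 := by
    rw [inv_le_comm₀ (by linarith) (by norm_num)]
    linarith
  have h3 : 0 ≤ |y| ^ 3 := by positivity
  norm_num
  nlinarith

/-- The ratio of `exp (i ∑ a_k / √n)` and `∏ (1 + i a_k / √n)` converges when the averages of the
squares do. -/
lemma tendsto_exp_sum_div_prod {a : ℕ → ℝ} {v : ℝ}
    (h : Tendsto (fun n : ℕ => (∑ k ∈ Finset.range n, a k ^ 2) / (n : ℝ)) atTop (𝓝 v)) :
    Tendsto (fun n : ℕ => Complex.exp (Complex.I * ∑ k ∈ Finset.range n, ((a k / √(n : ℝ) : ℝ) : ℂ))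
      / ∏ k ∈ Finset.range n, (1 + Complex.I * ((a k / √(n : ℝ) : ℝ) : ℂ))) atTop
      (𝓝 (Complex.exp (-(v : ℂ) / 2))) := by
  set y : ℕ → ℕ → ℝ := fun n k => a k / √(n : ℝ) with hy
  set E : ℕ → ℂ := fun n => ∑ k ∈ Finset.range n,
    (Complex.I * (y n k : ℂ) - Complex.log (1 + Complex.I * (y n k : ℂ))) with hE
  have hexp : ∀ n, Complex.exp (E n) = Complex.exp (Complex.I * ∑ k ∈ Finset.range n, (y n k : ℂ))
      / ∏ k ∈ Finset.range n, (1 + Complex.I * (y n k : ℂ)) := fun n => by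
    simp only [hE]
    rw [Finset.sum_sub_distrib, Complex.exp_sub, Finset.mul_sum, Complex.exp_sum _ (fun k =>
      Complex.log (1 + Complex.I * (y n k : ℂ)))]
    congr 1
    refine Finset.prod_congr rfl fun k _ => Complex.exp_log ?_
    have := one_le_norm_one_add_I_mul (y n k)
    intro h0
    rw [h0] at this
    norm_num at this
  have hsq : ∀ n : ℕ, ∑ k ∈ Finset.range n, y n k ^ 2
      = (∑ k ∈ Finset.range n, a k ^ 2) / (n : ℝ) := fun n => by
    rw [Finset.sum_div]
    exact Finset.sum_congr rfl fun k _ => by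
      rw [hy]
      simp only [div_pow]
      rw [Real.sq_sqrt (Nat.cast_nonneg n)]
  have hv : 0 ≤ v := ge_of_tendsto' h fun n => by positivity
  have hdiff : Tendsto (fun n : ℕ => E n + (((∑ k ∈ Finset.range n, a k ^ 2) / (n : ℝ) : ℝ) : ℂ) / 2)
      atTop (𝓝 0) := by
    rw [Metric.tendsto_nhds]
    intro ε hε
    -- The bound `1 / 2` is for the Taylor estimate. The other bound turns `∑ |y| ^ 3 ≤ δ ∑ y ^ 2`
    -- into at most `ε / 2`, since the sum of squares is eventually below `v + 1`.
    have hδ : 0 < min (1 / 2) (ε / (2 * (v + 1))) := by positivity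
    filter_upwards [eventually_forall_abs_le_of_tendsto_average h hδ,
      h.eventually_lt_const (lt_add_one v)] with n hn1 hn2
    rw [dist_zero_right]
    have hb : ‖E n + (((∑ k ∈ Finset.range n, a k ^ 2) / (n : ℝ) : ℝ) : ℂ) / 2‖
        ≤ ε / (2 * (v + 1)) * ∑ k ∈ Finset.range n, y n k ^ 2 := by
      rw [← hsq]
      push_cast
      rw [Finset.sum_div, ← Finset.sum_add_distrib, Finset.mul_sum]
      refine (norm_sum_le _ _).trans (Finset.sum_le_sum fun k hk => ?_)
      have h1 := hn1 k (Finset.mem_range.mp hk)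
      refine (norm_log_one_add_I_mul_sub_le (h1.trans (min_le_left _ _))).trans ?_
      rw [pow_succ', sq_abs]
      exact mul_le_mul_of_nonneg_right (h1.trans (min_le_right _ _)) (sq_nonneg _)
    refine hb.trans_lt ?_
    rw [hsq]
    have hp : 0 < ε / (2 * (v + 1)) := by positivity
    calc _ ≤ ε / (2 * (v + 1)) * (v + 1) := mul_le_mul_of_nonneg_left hn2.le hp.le
      _ = ε / 2 := by field_simp
      _ < ε := half_lt_self hε
  have hlim : Tendsto E atTop (𝓝 (-(v : ℂ) / 2)) := by
    have h1 := (Complex.continuous_ofReal.tendsto v).comp h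
    have h2 := hdiff.sub (h1.div_const 2)
    rw [zero_sub, ← neg_div] at h2
    refine h2.congr fun n => ?_
    simp
  exact ((Complex.continuous_exp.tendsto _).comp hlim).congr hexp

variable {Ω : Type*} {mΩ : MeasurableSpace Ω} {P : Measure Ω}

lemma measurable_stoppedProd {m : MeasurableSpace Ω} {X : ℕ → Ω → ℝ} {k : ℕ}
    (hX : ∀ j < k, Measurable (X j)) : Measurable fun ω => stoppedProd C (fun j => X j ω) k := by
  induction k with
  | zero => exact measurable_const
  | succ k ih =>
    simp only [stoppedProd]
    refine (ih fun j hj => hX j (hj.trans k.lt_succ_self)).mul (measurable_const.add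
      (measurable_const.mul (Complex.measurable_ofReal.comp
        (Measurable.ite (measurableSet_le ?_ measurable_const) (hX k k.lt_succ_self)
          measurable_const))))
    exact Finset.measurable_sum _ fun j hj =>
      (hX j ((Finset.mem_range.mp hj).trans k.lt_succ_self)).pow_const 2

lemma stoppedProd_congr {x y : ℕ → ℝ} {k : ℕ} (h : ∀ j < k, x j = y j) :
    stoppedProd C x k = stoppedProd C y k := by
  induction k with
  | zero => rfl
  | succ k ih =>
    have h1 : ∑ s ∈ Finset.range k, x s ^ 2 = ∑ s ∈ Finset.range k, y s ^ 2 :=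
      Finset.sum_congr rfl fun j hj => by rw [h j ((Finset.mem_range.mp hj).trans k.lt_succ_self)]
    rw [stoppedProd, stoppedProd, ih fun j hj => h j (hj.trans k.lt_succ_self), h1,
      h k k.lt_succ_self]

/-- The stopped products of martingale differences have mean one. -/
lemma integral_stoppedProd [IsProbabilityMeasure P] {F : ℕ → MeasurableSpace Ω} (hF : Monotone F)
    (hFle : ∀ k, F k ≤ mΩ) {X : ℕ → Ω → ℝ} (hXm : ∀ k, AEStronglyMeasurable[F (k + 1)] (X k) P)
    (hXi : ∀ k, Integrable (X k) P) (hX0 : ∀ k, P[X k | F k] =ᵐ[P] 0) (C : ℝ) (k : ℕ) :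
    Integrable (fun ω => stoppedProd C (fun j => X j ω) k) P ∧
      ∫ ω, stoppedProd C (fun j => X j ω) k ∂P = 1 := by
  induction k with
  | zero => simp [stoppedProd]
  | succ k ih =>
    have hmk : ∀ j < k, AEStronglyMeasurable[F k] (X j) P := fun j hj =>
      (hXm j).mono (hF hj)
    -- Adaptedness holds only up to null sets, so the earlier variables are replaced by versions
    -- that are genuinely `F k`-measurable.
    set X' : ℕ → Ω → ℝ := fun j => if hj : j < k then (hmk j hj).mk (X j) else 0 with hX'
    have hX'm : ∀ j, Measurable[F k] (X' j) := fun j => by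
      simp only [hX']
      split_ifs with hj
      · exact (hmk j hj).stronglyMeasurable_mk.measurable
      · exact measurable_const
    have hX'e : ∀ᵐ ω ∂P, ∀ j < k, X j ω = X' j ω := by
      rw [ae_all_iff]
      intro j
      by_cases hj : j < k
      · filter_upwards [(hmk j hj).ae_eq_mk] with ω hω _
        simp only [hX', dif_pos hj, hω]
      · exact ae_of_all _ fun ω h => absurd h hj
    -- The increment of the product is `X k` times this coefficient. It is known at time `k`, and
    -- bounded because the stopping rule keeps the product below `√(exp C)` while it is active.
    -- Hence it can be pulled out of the conditional expectation.
    set W' : Ω → ℂ := fun ω => if ∑ s ∈ Finset.range k, X' s ω ^ 2 ≤ C then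
      stoppedProd C (fun j => X' j ω) k * Complex.I else 0 with hW'
    have hW'm : Measurable[F k] W' :=
      Measurable.ite (measurableSet_le (Finset.measurable_sum _ fun j _ => (hX'm j).pow_const 2)
        measurable_const)
        ((measurable_stoppedProd fun j _ => hX'm j).mul measurable_const) measurable_const
    have hW'b : ∀ ω, ‖W' ω‖ ≤ √(Real.exp C) := fun ω => by
      simp only [hW']
      split_ifs with h
      · rw [norm_mul, Complex.norm_I, mul_one]
        exact Real.le_sqrt_of_sq_le (norm_stoppedProd_sq_le_of_sum_le h)
      · simp
    have hstep : ∀ᵐ ω ∂P, stoppedProd C (fun j => X j ω) (k + 1)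
        = stoppedProd C (fun j => X j ω) k + X k ω • W' ω := by
      filter_upwards [hX'e] with ω hω
      have h1 : ∑ s ∈ Finset.range k, X s ω ^ 2 = ∑ s ∈ Finset.range k, X' s ω ^ 2 :=
        Finset.sum_congr rfl fun j hj => by rw [hω j (Finset.mem_range.mp hj)]
      simp only [hW', stoppedProd]
      rw [h1, ← stoppedProd_congr hω]
      split_ifs
      · rw [Complex.real_smul]
        ring
      · simp
    have hprod : Integrable (fun ω => X k ω • W' ω) P := by
      refine ((hXi k).norm.mul_const (√(Real.exp C))).mono'
        ((hXi k).aestronglyMeasurable.smul ((hW'm.mono (hFle k) le_rfl).aestronglyMeasurable))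
        (ae_of_all _ fun ω => ?_)
      rw [norm_smul]
      exact mul_le_mul_of_nonneg_left (hW'b ω) (norm_nonneg _)
    have hzero : ∫ ω, X k ω • W' ω ∂P = 0 := by
      rw [← integral_condExp (hFle k)]
      have h := condExp_smul_of_aestronglyMeasurable_right (m := F k) (hXi k) hprod
        hW'm.stronglyMeasurable.aestronglyMeasurable
      rw [← integral_zero Ω ℂ (μ := P)]
      refine integral_congr_ae (h.trans ?_)
      filter_upwards [hX0 k] with ω hω
      simp [hω]
    refine ⟨(ih.1.add hprod).congr (hstep.mono fun ω h => h.symm), ?_⟩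
    rw [integral_congr_ae hstep, integral_add ih.1 hprod, ih.2, hzero, add_zero]

/-- The **central limit theorem for martingale differences** whose averages of squares converge to
their common second moment, in terms of characteristic functions. -/
theorem tendsto_integral_exp_martingaleDifference [IsProbabilityMeasure P]
    {F : ℕ → MeasurableSpace Ω} (hF : Monotone F) (hFle : ∀ k, F k ≤ mΩ) {X : ℕ → Ω → ℝ}
    (hXm : ∀ k, AEStronglyMeasurable[F (k + 1)] (X k) P) (hXi : ∀ k, Integrable (X k) P)
    (hX0 : ∀ k, P[X k | F k] =ᵐ[P] 0) {v : ℝ} (hXsq : ∀ k, Integrable (fun ω => X k ω ^ 2) P)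
    (hXv : ∀ k, ∫ ω, X k ω ^ 2 ∂P = v)
    (hlim : ∀ᵐ ω ∂P, Tendsto (fun n : ℕ => (∑ k ∈ Finset.range n, X k ω ^ 2) / (n : ℝ)) atTop
      (𝓝 v)) :
    Tendsto (fun n : ℕ => ∫ ω, Complex.exp
      (Complex.I * ∑ k ∈ Finset.range n, ((X k ω / √(n : ℝ) : ℝ) : ℂ)) ∂P) atTop
      (𝓝 (Complex.exp (-(v : ℂ) / 2))) := by
  have hv : 0 ≤ v := hXv 0 ▸ integral_nonneg fun ω => sq_nonneg _
  set c : ℂ := Complex.exp (-(v : ℂ) / 2) with hc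
  have hcn : ‖c‖ ≤ 1 := by
    rw [hc, show -(v : ℂ) / 2 = ((-v / 2 : ℝ) : ℂ) by push_cast; ring, Complex.norm_exp_ofReal]
    exact Real.exp_le_one_iff.mpr (by linarith)
  -- The averages of squares tend to `v`, so this threshold is eventually not reached and `T` is
  -- then the full product.
  set C : ℝ := v + 1
  have hXam : ∀ k, AEMeasurable (X k) P := fun k => (hXi k).aemeasurable
  set T : ℕ → Ω → ℂ := fun n ω => stoppedProd C (fun j => X j ω / √(n : ℝ)) n with hT
  set S : ℕ → Ω → ℂ := fun n ω => Complex.exp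
    (Complex.I * ∑ k ∈ Finset.range n, ((X k ω / √(n : ℝ) : ℝ) : ℂ)) with hS
  -- Since `T` has mean one, `E S - c = E (T D)`, where `D` is bounded by `2` and tends to `0`
  -- almost surely.
  set D : ℕ → Ω → ℂ := fun n ω => S n ω / T n ω - c with hD
  have hTi : ∀ n, Integrable (T n) P ∧ ∫ ω, T n ω ∂P = 1 := fun n => by
    refine integral_stoppedProd hF hFle (X := fun k ω => X k ω / √(n : ℝ)) (fun k => ?_)
      (fun k => (hXi k).div_const _) (fun k => ?_) C n
    · simp only [div_eq_mul_inv]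
      exact (hXm k).mul_const _
    · have h := condExp_smul (μ := P) (√(n : ℝ))⁻¹ (X k) (F k)
      have e : (fun ω => X k ω / √(n : ℝ)) = (√(n : ℝ))⁻¹ • X k := by
        ext ω
        simp [div_eq_inv_mul]
      rw [e]
      filter_upwards [h, hX0 k] with ω h1 h2
      simp [h1, h2]
  have hSn : ∀ n ω, ‖S n ω‖ = 1 := fun n ω => by
    simp only [hS]
    rw [← Complex.ofReal_sum, mul_comm]
    exact Complex.norm_exp_ofReal_mul_I _
  have hSm : ∀ n, AEStronglyMeasurable (S n) P := fun n => by
    have : AEMeasurable (S n) P := by fun_prop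
    exact this.aestronglyMeasurable
  have hDm : ∀ n, AEStronglyMeasurable (D n) P := fun n =>
    ((hSm n).aemeasurable.div (hTi n).1.aemeasurable).sub_const c |>.aestronglyMeasurable
  have hT1 : ∀ n ω, 1 ≤ ‖T n ω‖ := fun n ω => one_le_norm_stoppedProd n
  have hDb : ∀ n ω, ‖D n ω‖ ≤ 2 := fun n ω => by
    refine (norm_sub_le _ _).trans ?_
    have : ‖S n ω / T n ω‖ ≤ 1 := by
      rw [norm_div, hSn]
      exact (div_le_one (by linarith [hT1 n ω])).mpr (hT1 n ω)
    linarith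
  have hDlim : ∀ᵐ ω ∂P, Tendsto (fun n => ‖D n ω‖ ^ 2) atTop (𝓝 0) := by
    filter_upwards [hlim] with ω hω
    have h1 := tendsto_exp_sum_div_prod hω
    have h2 : Tendsto (fun n => D n ω) atTop (𝓝 0) := by
      rw [← sub_self c]
      refine (h1.sub_const c).congr' ?_
      filter_upwards [hω.eventually_lt_const (lt_add_one v)] with n hn
      have : ∑ k ∈ Finset.range n, (X k ω / √(n : ℝ)) ^ 2 ≤ C := by
        simp only [div_pow, Real.sq_sqrt (Nat.cast_nonneg n)]
        rw [← Finset.sum_div]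
        exact hn.le
      simp only [hD, hS, hT]
      rw [stoppedProd_eq_prod this]
    have := (h2.norm.pow 2)
    simpa using this
  have hDI : Tendsto (fun n => ∫ ω, ‖D n ω‖ ^ 2 ∂P) atTop (𝓝 0) := by
    have := tendsto_integral_of_dominated_convergence (fun _ => (4 : ℝ))
      (F := fun n ω => ‖D n ω‖ ^ 2) (fun n => ((hDm n).norm.aemeasurable.pow_const 2).aestronglyMeasurable)
      (integrable_const _) (fun n => ae_of_all _ fun ω => ?_) hDlim
    · simpa using this
    · rw [Real.norm_of_nonneg (by positivity)]
      nlinarith [hDb n ω, norm_nonneg (D n ω)]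
  have hTsq : ∀ n, Integrable (fun ω => ‖T n ω‖ ^ 2) P ∧
      ∫ ω, ‖T n ω‖ ^ 2 ∂P ≤ Real.exp C * (1 + v) := fun n => by
    have hdom : Integrable (fun ω => Real.exp C *
        (1 + ∑ s ∈ Finset.range n, (X s ω / √(n : ℝ)) ^ 2)) P := by
      refine Integrable.const_mul ((integrable_const _).add (integrable_finsetSum _ fun s _ => ?_)) _
      simp only [div_pow]
      exact (hXsq s).div_const _
    have hle : ∀ ω, ‖T n ω‖ ^ 2 ≤ Real.exp C *
        (1 + ∑ s ∈ Finset.range n, (X s ω / √(n : ℝ)) ^ 2) := fun ω =>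
      norm_stoppedProd_sq_le (by positivity) n
    have hi : Integrable (fun ω => ‖T n ω‖ ^ 2) P := by
      refine hdom.mono' ((hTi n).1.norm.aemeasurable.pow_const 2).aestronglyMeasurable
        (ae_of_all _ fun ω => ?_)
      rw [Real.norm_of_nonneg (by positivity)]
      exact hle ω
    refine ⟨hi, (integral_mono hi hdom hle).trans ?_⟩
    rw [integral_const_mul]
    refine mul_le_mul_of_nonneg_left ?_ (Real.exp_pos C).le
    simp only [div_pow, Real.sq_sqrt (Nat.cast_nonneg n)]
    rw [integral_add (integrable_const _) (integrable_finsetSum _ fun s _ => (hXsq s).div_const _),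
      integral_finsetSum _ fun s _ => (hXsq s).div_const _]
    simp only [integral_div, hXv, integral_const, probReal_univ, smul_eq_mul, one_mul,
      Finset.sum_const, Finset.card_range, nsmul_eq_mul]
    rcases Nat.eq_zero_or_pos n with h | h
    · simp [h, hv]
    · have : (n : ℝ) ≠ 0 := by exact_mod_cast h.ne'
      rw [mul_div_cancel₀ _ this]
  -- Young's inequality with weight `δ`: the `T` part is uniformly bounded and made small by `δ`,
  -- then the `D` part vanishes as `n` grows.
  have hkey : ∀ n, ∀ δ > 0, ‖∫ ω, S n ω ∂P - c‖
      ≤ δ * (Real.exp C * (1 + v)) + δ⁻¹ * ∫ ω, ‖D n ω‖ ^ 2 ∂P := fun n δ hδ => by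
    have hSi : Integrable (S n) P := .of_bound (hSm n) 1 (ae_of_all _ fun ω => (hSn n ω).le)
    have hDsq : Integrable (fun ω => ‖D n ω‖ ^ 2) P := by
      refine .of_bound ((hDm n).norm.aemeasurable.pow_const 2).aestronglyMeasurable 4
        (ae_of_all _ fun ω => ?_)
      rw [Real.norm_of_nonneg (by positivity)]
      nlinarith [hDb n ω, norm_nonneg (D n ω)]
    have h1 : ∫ ω, S n ω ∂P - c = ∫ ω, (S n ω - T n ω * c) ∂P := by
      rw [integral_sub hSi ((hTi n).1.mul_const c), integral_mul_const, (hTi n).2, one_mul]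
    rw [h1, ← integral_const_mul]
    refine (norm_integral_le_of_norm_le (g := fun ω => δ * ‖T n ω‖ ^ 2 + δ⁻¹ * ‖D n ω‖ ^ 2)
      (((hTsq n).1.const_mul δ).add (hDsq.const_mul δ⁻¹)) (ae_of_all _ fun ω => ?_)).trans ?_
    · have hT0 : T n ω ≠ 0 := norm_pos_iff.mp (by linarith [hT1 n ω])
      have e : S n ω - T n ω * c = T n ω * D n ω := by
        simp only [hD]
        rw [mul_sub, mul_div_cancel₀ _ hT0]
      rw [e, norm_mul]
      have h2 : 0 ≤ δ⁻¹ * (δ * ‖T n ω‖ - ‖D n ω‖) ^ 2 := by positivity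
      have h3 : δ⁻¹ * (δ * ‖T n ω‖ - ‖D n ω‖) ^ 2
          = δ * ‖T n ω‖ ^ 2 + δ⁻¹ * ‖D n ω‖ ^ 2 - 2 * (‖T n ω‖ * ‖D n ω‖) := by
        field_simp
        ring
      have h4 : 0 ≤ ‖T n ω‖ * ‖D n ω‖ := by positivity
      linarith
    · rw [integral_add ((hTsq n).1.const_mul δ) (hDsq.const_mul δ⁻¹), integral_const_mul]
      have := mul_le_mul_of_nonneg_left (hTsq n).2 hδ.le
      linarith [integral_const_mul (μ := P) δ⁻¹ fun ω => ‖D n ω‖ ^ 2]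
  rw [tendsto_iff_norm_sub_tendsto_zero, Metric.tendsto_nhds]
  intro ε hε
  have hM : 0 < Real.exp C * (1 + v) := by positivity
  set δ : ℝ := ε / (2 * (Real.exp C * (1 + v)))
  have hδ : 0 < δ := by positivity
  have h5 := (hDI.const_mul δ⁻¹)
  rw [mul_zero] at h5
  filter_upwards [h5.eventually_lt_const (half_pos hε)] with n hn
  rw [Real.dist_eq, sub_zero, abs_of_nonneg (norm_nonneg _)]
  have h6 : δ * (Real.exp C * (1 + v)) = ε / 2 := by
    simp only [δ]
    field_simp
  linarith [hkey n δ hδ]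

end MartingaleCLT

/-! ### Identification of the scale by the density power divergence -/

section Identification

/-- The density power divergence of two numbers `a, b ≥ 0`, the pointwise integrand of the
divergence of two densities. -/
noncomputable def pointDivergence (γ a b : ℝ) : ℝ :=
  if γ = 0 then a * (Real.log a - Real.log b) - a + b
  else a * (1 / γ * a ^ γ - 1 / γ * b ^ γ) - 1 / (1 + γ) * a ^ (1 + γ) + 1 / (1 + γ) * b ^ (1 + γ)

lemma pointDivergence_self (γ a : ℝ) : pointDivergence γ a a = 0 := by
  unfold pointDivergence
  split_ifs <;> ring

/-- For `γ = 0` this is `log x < x - 1` at `x = b / a`. For `γ > 0` and `b > 0` it is the strict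
Bernoulli inequality with exponent `1 + γ` at `a / b`. The hypothesis `h0` rules out `a > 0 = b` at
`γ = 0`, where the convention `log 0 = 0` would replace an infinite divergence by a finite value. -/
lemma pointDivergence_pos {γ a b : ℝ} (hγ : 0 ≤ γ) (ha : 0 ≤ a) (hb : 0 ≤ b) (hab : a ≠ b)
    (h0 : γ = 0 → 0 < a → 0 < b) : 0 < pointDivergence γ a b := by
  unfold pointDivergence
  split_ifs with hγ0
  · rcases ha.eq_or_lt with rfl | ha'
    · simpa using hb.lt_of_ne hab
    · have hb' := h0 hγ0 ha'
      have h := Real.log_lt_sub_one_of_pos (div_pos hb' ha')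
        (fun h => hab ((div_eq_one_iff_eq ha'.ne').mp h).symm)
      rw [Real.log_div hb'.ne' ha'.ne'] at h
      have h2 := mul_lt_mul_of_pos_left h ha'
      have h3 : a * (b / a - 1) = b - a := by field_simp
      rw [h3] at h2
      linarith
  · have hγ' : 0 < γ := hγ.lt_of_ne (Ne.symm hγ0)
    have hγ1 : 0 < 1 + γ := by linarith
    have e1 : a * a ^ γ = a ^ (1 + γ) := by
      rw [Real.rpow_add_of_nonneg ha zero_le_one hγ, Real.rpow_one]
    rcases hb.eq_or_lt with rfl | hb'
    · have ha' : 0 < a := ha.lt_of_ne (Ne.symm hab)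
      rw [Real.zero_rpow hγ0, Real.zero_rpow hγ1.ne', mul_zero, mul_zero, sub_zero, add_zero,
        mul_left_comm, e1]
      have h1 : 0 < a ^ (1 + γ) := Real.rpow_pos_of_pos ha' _
      have h2 : 1 / (1 + γ) < 1 / γ := one_div_lt_one_div_of_lt hγ' (by linarith)
      nlinarith
    · have h := one_add_mul_self_lt_rpow_one_add (s := a / b - 1) (p := 1 + γ)
        (by have := div_nonneg ha hb; linarith)
        (fun h => hab ((div_eq_one_iff_eq hb'.ne').mp (by linarith))) (by linarith)
      rw [add_sub_cancel, Real.div_rpow ha hb] at h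
      have hbp : 0 < b ^ (1 + γ) := Real.rpow_pos_of_pos hb' _
      have h2 := mul_lt_mul_of_pos_right h hbp
      rw [div_mul_cancel₀ _ hbp.ne'] at h2
      have e2 : b ^ (1 + γ) = b * b ^ γ := by
        rw [Real.rpow_add_of_nonneg hb zero_le_one hγ, Real.rpow_one]
      have e3 : (1 + (1 + γ) * (a / b - 1)) * b ^ (1 + γ)
          = (1 + γ) * (a * b ^ γ) - γ * b ^ (1 + γ) := by
        rw [e2]
        field_simp
        ring
      rw [e3] at h2
      have e4 : a * (1 / γ * a ^ γ - 1 / γ * b ^ γ) - 1 / (1 + γ) * a ^ (1 + γ)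
            + 1 / (1 + γ) * b ^ (1 + γ)
          = (a ^ (1 + γ) - ((1 + γ) * (a * b ^ γ) - γ * b ^ (1 + γ))) / (γ * (1 + γ)) := by
        rw [← e1]
        field_simp
        ring
      rw [e4]
      exact div_pos (by linarith) (by positivity)

variable {f : ℝ → ℝ} {γ : ℝ}

lemma scaledDensity_nonneg (hf : ∀ x, 0 ≤ f x) {s : ℝ} (hs : 0 < s) (x : ℝ) :
    0 ≤ scaledDensity f s x :=
  mul_nonneg (by positivity) (hf _)

lemma integrable_scaledDensity_rpow (hf : ∀ x, 0 ≤ f x) {p : ℝ} (hfp : Integrable fun x => f x ^ p)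
    {s : ℝ} (hs : 0 < s) : Integrable fun x => scaledDensity f s x ^ p := by
  have h := (hfp.comp_div hs.ne').const_mul ((1 / s) ^ p)
  refine h.congr (ae_of_all _ fun x => ?_)
  simp only [scaledDensity]
  rw [Real.mul_rpow (by positivity) (hf _)]

lemma integral_scaledDensity {s : ℝ} (hs : 0 < s) :
    ∫ x, scaledDensity f s x = ∫ x, f x := by
  simp only [scaledDensity]
  rw [integral_const_mul, Measure.integral_comp_div, abs_of_pos hs, smul_eq_mul]
  field_simp

lemma integral_sq_mul_scaledDensity {s : ℝ} (hs : 0 < s) :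
    ∫ x, x ^ 2 * scaledDensity f s x = s ^ 2 * ∫ x, x ^ 2 * f x := by
  have h : (fun x => x ^ 2 * scaledDensity f s x)
      = fun x => s * ((fun y => y ^ 2 * f y) (x / s)) := by
    ext x
    simp only [scaledDensity]
    field_simp
  rw [h, integral_const_mul, Measure.integral_comp_div (fun y => y ^ 2 * f y), abs_of_pos hs, smul_eq_mul]
  ring

/-- The gain in expected criterion of the true scale `s₀` over the scale `s` is nonnegative, and
vanishes only for `s = s₀`. -/
theorem integral_mul_dpdTerm_sub (hγ : 0 ≤ γ) (hf : ∀ x, 0 ≤ f x) (hf1 : ∫ x, f x = 1)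
    (hf2 : ∫ x, x ^ 2 * f x = 1) (hfγ : Integrable fun x => f x ^ (1 + γ)) {s s₀ : ℝ}
    (hs : 0 < s) (hs₀ : 0 < s₀)
    (hint : Integrable fun e => f e * (dpdTerm γ f s₀ (s₀ * e) - dpdTerm γ f s (s₀ * e)))
    (hpos : γ = 0 → ∀ᵐ e, 0 < f e → 0 < scaledDensity f s (s₀ * e)) :
    0 ≤ ∫ e, f e * (dpdTerm γ f s₀ (s₀ * e) - dpdTerm γ f s (s₀ * e)) ∧
      (∫ e, f e * (dpdTerm γ f s₀ (s₀ * e) - dpdTerm γ f s (s₀ * e)) = 0 → s = s₀) := by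
  have hfi : Integrable f := by
    by_contra h
    rw [integral_undef h] at hf1
    exact zero_ne_one hf1
  set c : ℝ → ℝ := fun r => ∫ y, scaledDensity f r y ^ (1 + γ) with hc
  have hfs : ∀ e, f e = s₀ * scaledDensity f s₀ (s₀ * e) := fun e => by
    simp only [scaledDensity]
    rw [mul_div_cancel_left₀ _ hs₀.ne']
    field_simp
  have hci : ∀ r, 0 < r → Integrable (fun e => s₀ * scaledDensity f r (s₀ * e) ^ (1 + γ)) ∧
      ∫ e, s₀ * scaledDensity f r (s₀ * e) ^ (1 + γ) = c r := fun r hr => by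
    have h := integrable_scaledDensity_rpow hf hfγ hr
    refine ⟨(h.comp_mul_left' hs₀.ne').const_mul s₀, ?_⟩
    rw [integral_const_mul, Measure.integral_comp_mul_left
      (fun x => scaledDensity f r x ^ (1 + γ)), abs_of_pos (inv_pos.mpr hs₀), smul_eq_mul,
      mul_inv_cancel_left₀ hs₀.ne']
  have hc0 : γ = 0 → ∀ r, 0 < r → c r = 1 := fun h r hr => by
    simp only [hc, h, add_zero, Real.rpow_one]
    rw [integral_scaledDensity hr, hf1]
  set k : ℝ → ℝ := fun e =>
    s₀ * pointDivergence γ (scaledDensity f s₀ (s₀ * e)) (scaledDensity f s (s₀ * e)) with hk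
  -- The correction terms integrate to zero, because `f` has mass one and `c s₀`, `c s` are the
  -- integrals of the two powers. For `γ = 0` both equal one, which absorbs the `- a + b` of the
  -- divergence.
  have hkeq : k = fun e => (f e * (dpdTerm γ f s₀ (s₀ * e) - dpdTerm γ f s (s₀ * e))
      + 1 / (1 + γ) * (c s₀ - c s) * f e)
      - 1 / (1 + γ) * (s₀ * scaledDensity f s₀ (s₀ * e) ^ (1 + γ))
      + 1 / (1 + γ) * (s₀ * scaledDensity f s (s₀ * e) ^ (1 + γ)) := by
    ext e
    have h1 := hfs e
    by_cases h0 : γ = 0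
    · rw [hc0 h0 s hs, hc0 h0 s₀ hs₀]
      simp only [hk, pointDivergence, dpdTerm, if_pos h0]
      rw [h0, add_zero, Real.rpow_one, Real.rpow_one, h1]
      ring
    · simp only [hk, pointDivergence, dpdTerm, if_neg h0]
      rw [h1]
      simp only [hc]
      ring
  have hi1 : Integrable fun e => 1 / (1 + γ) * (c s₀ - c s) * f e := hfi.const_mul _
  have hi2 : Integrable fun e => 1 / (1 + γ) * (s₀ * scaledDensity f s₀ (s₀ * e) ^ (1 + γ)) :=
    (hci s₀ hs₀).1.const_mul _
  have hi3 : Integrable fun e => 1 / (1 + γ) * (s₀ * scaledDensity f s (s₀ * e) ^ (1 + γ)) :=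
    (hci s hs).1.const_mul _
  have hi4 : Integrable fun e => f e * (dpdTerm γ f s₀ (s₀ * e) - dpdTerm γ f s (s₀ * e))
      + 1 / (1 + γ) * (c s₀ - c s) * f e := hint.add hi1
  have hi5 : Integrable fun e => f e * (dpdTerm γ f s₀ (s₀ * e) - dpdTerm γ f s (s₀ * e))
      + 1 / (1 + γ) * (c s₀ - c s) * f e
      - 1 / (1 + γ) * (s₀ * scaledDensity f s₀ (s₀ * e) ^ (1 + γ)) := hi4.sub hi2
  have hki : Integrable k := by
    rw [hkeq]
    exact hi5.add hi3
  have hkI : ∫ e, k e = ∫ e, f e * (dpdTerm γ f s₀ (s₀ * e) - dpdTerm γ f s (s₀ * e)) := by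
    rw [hkeq, integral_add hi5 hi3, integral_sub hi4 hi2, integral_add hint hi1,
      integral_const_mul (1 / (1 + γ) * (c s₀ - c s)), integral_const_mul (1 / (1 + γ)),
      integral_const_mul (1 / (1 + γ)), (hci s₀ hs₀).2, (hci s hs).2, hf1]
    ring
  have hdich : ∀ᵐ e, 0 ≤ k e ∧
      (k e = 0 → scaledDensity f s₀ (s₀ * e) = scaledDensity f s (s₀ * e)) := by
    have hp : ∀ᵐ e, γ = 0 → 0 < f e → 0 < scaledDensity f s (s₀ * e) := by
      by_cases h : γ = 0
      · filter_upwards [hpos h] with e he _ using he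
      · exact ae_of_all _ fun e h' => absurd h' h
    filter_upwards [hp] with e he
    by_cases hab : scaledDensity f s₀ (s₀ * e) = scaledDensity f s (s₀ * e)
    · exact ⟨by simp only [hk]; rw [hab, pointDivergence_self, mul_zero], fun _ => hab⟩
    · have := pointDivergence_pos hγ (scaledDensity_nonneg hf hs₀ (s₀ * e))
        (scaledDensity_nonneg hf hs (s₀ * e)) hab
        (fun h h' => he h (by rw [hfs e]; positivity))
      have hkp : 0 < k e := mul_pos hs₀ this
      exact ⟨hkp.le, fun h => absurd h hkp.ne'⟩
  rw [← hkI]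
  refine ⟨integral_nonneg_of_ae (hdich.mono fun e h => h.1), fun h0 => ?_⟩
  rw [integral_eq_zero_iff_of_nonneg_ae (hdich.mono fun e h => h.1) hki] at h0
  -- The densities agree almost everywhere. Their second moments are `s₀ ^ 2` and `s ^ 2`, and this
  -- is where the unit variance identifies the scale.
  have hd : ∀ᵐ e, (fun x => x ^ 2 * scaledDensity f s₀ x) (s₀ * e)
      = (fun x => x ^ 2 * scaledDensity f s x) (s₀ * e) := by
    filter_upwards [hdich, h0] with e h1 h2
    rw [h1.2 h2]
  have hI := integral_congr_ae hd
  rw [Measure.integral_comp_mul_left (fun x => x ^ 2 * scaledDensity f s₀ x),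
    Measure.integral_comp_mul_left (fun x => x ^ 2 * scaledDensity f s x),
    integral_sq_mul_scaledDensity hs₀, integral_sq_mul_scaledDensity hs, hf2, mul_one, mul_one,
    smul_eq_mul, smul_eq_mul, abs_of_pos (inv_pos.mpr hs₀)] at hI
  have h3 := mul_left_cancel₀ (inv_pos.mpr hs₀).ne' hI
  exact ((sq_eq_sq₀ hs₀.le hs.le).mp h3).symm

lemma measurable_scaledDensity (hf : Measurable f) :
    Measurable fun z : ℝ × ℝ => scaledDensity f z.1 z.2 := by
  unfold scaledDensity
  fun_prop

lemma measurable_dpdTerm (hf : Measurable f) (γ : ℝ) :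
    Measurable fun z : ℝ × ℝ => dpdTerm γ f z.1 z.2 := by
  have h := measurable_scaledDensity hf
  unfold dpdTerm
  split_ifs
  · exact h.log
  · refine ((h.pow_const γ).const_mul _).sub (Measurable.const_mul ?_ _)
    have h2 : StronglyMeasurable fun z : ℝ × ℝ => scaledDensity f z.1 z.2 ^ (1 + γ) :=
      (h.pow_const _).stronglyMeasurable
    exact h2.integral_prod_right'.measurable.comp measurable_fst

/-- A random scale that does at least as well in expected criterion as the true one is almost
surely equal to it. -/
theorem scale_ae_eq_of_integral_dpdTerm_le {Ω : Type*} [MeasurableSpace Ω] {P : Measure Ω}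
    [IsProbabilityMeasure P] (hγ : 0 ≤ γ) (hfm : Measurable f) (hf : ∀ x, 0 ≤ f x)
    (hfγ : Integrable fun x => f x ^ (1 + γ)) {S S₀ e x : Ω → ℝ} (hS : Measurable S)
    (hS₀ : Measurable S₀) (he : Measurable e) (hSpos : ∀ ω, 0 < S ω) (hS₀pos : ∀ ω, 0 < S₀ ω)
    (hlaw : P.map e = volume.withDensity fun x => ENNReal.ofReal (f x))
    (hvar : ∫ ω, e ω ^ 2 ∂P = 1) (hindep : IndepFun (fun ω => (S ω, S₀ ω)) e P)
    (hx : ∀ᵐ ω ∂P, x ω = S₀ ω * e ω)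
    (hint : Integrable (fun ω => dpdTerm γ f (S ω) (x ω)) P)
    (hint₀ : Integrable (fun ω => dpdTerm γ f (S₀ ω) (x ω)) P)
    (hpos : γ = 0 → ∀ᵐ ω ∂P, 0 < scaledDensity f (S ω) (x ω))
    (hle : ∫ ω, dpdTerm γ f (S₀ ω) (x ω) ∂P ≤ ∫ ω, dpdTerm γ f (S ω) (x ω) ∂P) :
    ∀ᵐ ω ∂P, S ω = S₀ ω := by
  have hlaw_int : ∀ g : ℝ → ℝ, ∫ y, g y ∂(P.map e) = ∫ y, f y * g y := fun g => by
    rw [hlaw, integral_withDensity_eq_integral_toReal_smul (by fun_prop)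
      (ae_of_all _ fun _ => ENNReal.ofReal_lt_top)]
    simp only [ENNReal.toReal_ofReal (hf _), smul_eq_mul]
  have hlaw_integrable : ∀ g : ℝ → ℝ, Integrable g (P.map e) ↔ Integrable fun y => f y * g y :=
    fun g => by
      rw [hlaw, integrable_withDensity_iff_integrable_smul' (by fun_prop)
        (ae_of_all _ fun _ => ENNReal.ofReal_lt_top)]
      simp only [ENNReal.toReal_ofReal (hf _), smul_eq_mul]
  have hlaw_prob : IsProbabilityMeasure (P.map e) := Measure.isProbabilityMeasure_map he.aemeasurable
  have hf1 : ∫ y, f y = 1 := by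
    have := hlaw_int fun _ => 1
    simpa using this.symm
  have hf2 : ∫ y, y ^ 2 * f y = 1 := by
    have := hlaw_int fun y => y ^ 2
    rw [integral_map he.aemeasurable (by fun_prop), hvar] at this
    rw [this]
    simp only [mul_comm]
  have hp : Measurable fun ω => (S ω, S₀ ω) := hS.prodMk hS₀
  have hmap := (indepFun_iff_map_prod_eq_prod_map_map hp.aemeasurable he.aemeasurable).mp hindep
  have hpe : Measurable fun ω => ((S ω, S₀ ω), e ω) := hp.prodMk he
  set ν : Measure (ℝ × ℝ) := P.map fun ω => (S ω, S₀ ω)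
  have hνprob : IsProbabilityMeasure ν := Measure.isProbabilityMeasure_map hp.aemeasurable
  -- By independence the joint law is a product, so Fubini allows the scales to be frozen and the
  -- deterministic gain inequality applied to each pair.
  set ψ : (ℝ × ℝ) × ℝ → ℝ := fun z =>
    dpdTerm γ f z.1.2 (z.1.2 * z.2) - dpdTerm γ f z.1.1 (z.1.2 * z.2) with hψ
  have hψm : Measurable ψ := by
    have h := measurable_dpdTerm hfm γ
    exact (h.comp (f := fun z : (ℝ × ℝ) × ℝ => (z.1.2, z.1.2 * z.2)) (by fun_prop)).sub
      (h.comp (f := fun z : (ℝ × ℝ) × ℝ => (z.1.1, z.1.2 * z.2)) (by fun_prop))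
  have hψe : (fun ω => dpdTerm γ f (S₀ ω) (x ω) - dpdTerm γ f (S ω) (x ω))
      =ᵐ[P] fun ω => ψ ((S ω, S₀ ω), e ω) := by
    filter_upwards [hx] with ω hω
    simp only [hψ, hω]
  have hψi : Integrable ψ (ν.prod (P.map e)) := by
    rw [← hmap, integrable_map_measure hψm.aestronglyMeasurable hpe.aemeasurable]
    exact (hint₀.sub hint).congr hψe
  have hψI : ∫ z, ψ z ∂(ν.prod (P.map e)) ≤ 0 := by
    rw [← hmap, integral_map hpe.aemeasurable hψm.aestronglyMeasurable, ← integral_congr_ae hψe,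
      integral_sub hint₀ hint]
    linarith
  have hνpos : ∀ᵐ z ∂ν, 0 < z.1 ∧ 0 < z.2 := by
    have hm : MeasurableSet {z : ℝ × ℝ | 0 < z.1 ∧ 0 < z.2} :=
      (measurableSet_lt measurable_const measurable_fst).inter
        (measurableSet_lt measurable_const measurable_snd)
    exact (ae_map_iff hp.aemeasurable hm).mpr (ae_of_all _ fun ω => ⟨hSpos ω, hS₀pos ω⟩)
  have hνdens : γ = 0 → ∀ᵐ z ∂ν, ∀ᵐ y, 0 < f y → 0 < scaledDensity f z.1 (z.2 * y) := fun h0 => by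
    have hm : MeasurableSet
        {z : (ℝ × ℝ) × ℝ | 0 < scaledDensity f z.1.1 (z.1.2 * z.2)} :=
      measurableSet_lt measurable_const ((measurable_scaledDensity hfm).comp
        (f := fun z : (ℝ × ℝ) × ℝ => (z.1.1, z.1.2 * z.2)) (by fun_prop))
    have h1 : ∀ᵐ z ∂(ν.prod (P.map e)), 0 < scaledDensity f z.1.1 (z.1.2 * z.2) := by
      rw [← hmap, ae_map_iff hpe.aemeasurable hm]
      filter_upwards [hpos h0, hx] with ω h1 h2
      rwa [← h2]
    filter_upwards [Measure.ae_ae_of_ae_prod h1] with z hz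
    rw [hlaw, ae_withDensity_iff (by fun_prop)] at hz
    filter_upwards [hz] with y hy hfy
    exact hy (by simpa using hfy)
  have hgain : ∀ᵐ z ∂ν, 0 ≤ ∫ y, ψ (z, y) ∂(P.map e) ∧
      (∫ y, ψ (z, y) ∂(P.map e) = 0 → z.1 = z.2) := by
    have hd : ∀ᵐ z ∂ν, γ = 0 → ∀ᵐ y, 0 < f y → 0 < scaledDensity f z.1 (z.2 * y) := by
      by_cases h : γ = 0
      · filter_upwards [hνdens h] with z hz _ using hz
      · exact ae_of_all _ fun z h' => absurd h' h
    filter_upwards [hνpos, hd, hψi.prod_right_ae] with z h1 h2 h3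
    have h4 := (hlaw_integrable _).mp h3
    simp only [hψ] at h4
    simp only [hψ, hlaw_int]
    exact integral_mul_dpdTerm_sub (s := z.1) (s₀ := z.2) hγ hf hf1 hf2 hfγ h1.1 h1.2 h4 h2
  -- The gain is nonnegative for almost every pair of scales, and its total is at most zero, so it
  -- vanishes almost surely.
  rw [integral_prod _ hψi] at hψI
  have hnn : 0 ≤ᵐ[ν] fun z => ∫ y, ψ (z, y) ∂(P.map e) := hgain.mono fun z h => h.1
  have hzero : ∫ z, ∫ y, ψ (z, y) ∂(P.map e) ∂ν = 0 :=
    le_antisymm hψI (integral_nonneg_of_ae hnn)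
  have h0 := (integral_eq_zero_iff_of_nonneg_ae hnn hψi.integral_prod_left).mp hzero
  have hfinal : ∀ᵐ z ∂ν, z.1 = z.2 := by
    filter_upwards [hgain, h0] with z h1 h2 using h1.2 h2
  exact ae_of_ae_map hp.aemeasurable hfinal

end Identification

/-! ### Strong consistency -/

section Consistency

/-- Turns the extended-valued conditions A2 and A5, whose suprema may be infinite, into real bounds
uniform in the parameter. -/
lemma eventually_forall_average_le {V : Type*} {K : Set V} {u : ℕ → V → ℝ}
    (hu : ∀ t, ∀ θ ∈ K, 0 ≤ u t θ)
    (h : Tendsto (fun n : ℕ => (∑ t ∈ Finset.Icc 1 n, ⨆ θ ∈ K, ENNReal.ofReal (u t θ)) / (n : ℝ≥0∞))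
      atTop (𝓝 0)) {δ : ℝ} (hδ : 0 < δ) :
    ∀ᶠ n : ℕ in atTop, ∀ θ ∈ K, (∑ t ∈ Finset.Icc 1 n, u t θ) / (n : ℝ) ≤ δ := by
  filter_upwards [h.eventually_le_const (ENNReal.ofReal_pos.mpr hδ), eventually_gt_atTop 0]
    with n hn hn0 θ hθ
  have hn' : (0 : ℝ) < n := by exact_mod_cast hn0
  rw [← ENNReal.ofReal_le_ofReal_iff hδ.le, ENNReal.ofReal_div_of_pos hn', ENNReal.ofReal_natCast,
    ENNReal.ofReal_sum_of_nonneg fun t _ => hu t θ hθ]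
  refine le_trans ?_ hn
  gcongr with t _
  exact le_iSup₂_of_le θ hθ le_rfl

variable {Ω : Type*} [MeasurableSpace Ω] {d : ℕ} {P : Measure Ω}
  {Θ : Set (EuclideanSpace ℝ (Fin d))} {θ₀ : EuclideanSpace ℝ (Fin d)}
  {q : ℤ → EuclideanSpace ℝ (Fin d) → Ω → ℝ} {qt : ℕ → EuclideanSpace ℝ (Fin d) → Ω → ℝ}

/-- The path of a random function on `Θ`, evaluated at a point of `Θ`. -/
lemma isFactor_eval {θ : EuclideanSpace ℝ (Fin d)} (hθ : θ ∈ Θ) :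
    IsFactor P (fun t ω (η : Θ) => q t η ω) (fun t => q t θ) :=
  ⟨fun y => y ⟨θ, hθ⟩, measurable_pi_apply _, fun _ => ae_of_all _ fun _ => rfl⟩

lemma integrable_criterionTerm (hA1 : A1 P Θ q) (hA2 : A2 P Θ q qt)
    {θ : EuclideanSpace ℝ (Fin d)} (hθ : θ ∈ Θ) (t : ℤ) : Integrable (q t θ) P :=
  integrable_of_lintegral_iSup_lt_top hθ ((isFactor_eval hθ).aemeasurable hA1.2 t) (hA2.1 t)

/-- The maximizer of the feasible criterion is strongly consistent when the expected criterion is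
uniquely maximized at `θ₀`. -/
theorem tendsto_mdpde [IsProbabilityMeasure P] (hΘ : IsCompact Θ) (hθ₀ : θ₀ ∈ Θ)
    {θhat : ℕ → Ω → EuclideanSpace ℝ (Fin d)} (hθhat : IsMDPDE P Θ qt θhat)
    (hA1 : A1 P Θ q) (hA2 : A2 P Θ q qt)
    (hmax : ∀ θ ∈ Θ, θ ≠ θ₀ → ∫ ω, q 0 θ ω ∂P < ∫ ω, q 0 θ₀ ω ∂P) :
    ∀ᵐ ω ∂P, Tendsto (fun n => θhat n ω) atTop (𝓝 θ₀) := by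
  have hhat : ∀ᵐ ω ∂P, ∀ n, 1 ≤ n →
      θhat n ω ∈ Θ ∧ IsMaxOn (fun θ => criterion qt n θ ω) Θ (θhat n ω) := by
    rw [ae_all_iff]
    intro n
    by_cases hn : 1 ≤ n
    · filter_upwards [hθhat.2 n hn] with ω hω _ using hω
    · exact ae_of_all _ fun ω h => absurd h hn
  have hloc : ∀ θ₁ ∈ Θ, θ₁ ≠ θ₀ → ∃ r > 0, ∀ᵐ ω ∂P, ∀ᶠ n in atTop,
      θhat n ω ∉ Metric.ball θ₁ r := fun θ₁ hθ₁ hne => by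
    set Δ : ℝ := ∫ ω, q 0 θ₀ ω ∂P - ∫ ω, q 0 θ₁ ω ∂P with hΔ
    have hΔpos : 0 < Δ := sub_pos.mpr (hmax θ₁ hθ₁ hne)
    -- Four errors of size `Δ / 5` arise: the uniform law near `θ₁`, the law at `θ₀`, and the proxy
    -- error at each of the two points. Their sum stays below the gap `Δ`.
    have hε : 0 < Δ / 5 := by positivity
    obtain ⟨r, hr, hball⟩ := exists_ball_average_sub_le hA1.2 (Z := q)
      (fun θ hθ => isFactor_eval hθ) hA1.1 (hA2.1 0) hθ₁ hε
    refine ⟨r, hr, ?_⟩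
    have hLLN := (isFactor_eval (q := q) hθ₀).tendsto_average hA1.2
      (integrable_criterionTerm hA1 hA2 hθ₀ 0)
    filter_upwards [hball, hLLN, hA2.2, hhat] with ω h1 h2 h3 h4
    filter_upwards [h1, h2.eventually_const_le (u := ∫ ω, q 0 θ₀ ω ∂P - Δ / 5) (by linarith),
      eventually_forall_average_le (u := fun t θ => |q t θ ω - qt t θ ω|)
        (fun _ _ _ => abs_nonneg _) h3 hε, eventually_ge_atTop 1] with n hn1 hn2 hn3 hn4 hmem
    obtain ⟨hin, hmaxn⟩ := h4 n hn4
    have hn' : (0 : ℝ) < n := by exact_mod_cast hn4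
    have hdiff : ∀ θ ∈ Θ, |(∑ t ∈ Finset.Icc 1 n, q t θ ω) / (n : ℝ) - criterion qt n θ ω / n|
        ≤ Δ / 5 := fun θ hθ => by
      refine le_trans ?_ (hn3 θ hθ)
      rw [criterion, ← sub_div, ← Finset.sum_sub_distrib, abs_div, Nat.abs_cast]
      gcongr
      exact Finset.abs_sum_le_sum_abs _ _
    have h5 := hn1 _ ⟨hin, hmem⟩
    have h6 := hdiff _ hin
    have h7 := hdiff _ hθ₀
    have h8 : criterion qt n θ₀ ω / n ≤ criterion qt n (θhat n ω) ω / n := by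
      have : criterion qt n θ₀ ω ≤ criterion qt n (θhat n ω) ω := hmaxn hθ₀
      gcongr
    rw [abs_le] at h5 h6 h7
    linarith [h5.2, h6.1, h7.2]
  have hout : ∀ k : ℕ, ∀ᵐ ω ∂P, ∀ᶠ n in atTop,
      θhat n ω ∉ Θ \ Metric.ball θ₀ (1 / ((k : ℝ) + 1)) := fun k => by
    -- Avoidance of a set passes to subsets and finite unions, so the local statements at points
    -- other than `θ₀` cover the compact complement of the ball.
    refine IsCompact.induction_on (p := fun s => ∀ᵐ ω ∂P, ∀ᶠ n in atTop, θhat n ω ∉ s)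
      (hΘ.diff Metric.isOpen_ball) (ae_of_all _ fun ω => Eventually.of_forall fun n => id)
      (fun s t hst ht => ?_) (fun s t hs ht => ?_) (fun θ₁ hθ₁ => ?_)
    · filter_upwards [ht] with ω hω
      exact hω.mono fun n hn h => hn (hst h)
    · filter_upwards [hs, ht] with ω h1 h2
      filter_upwards [h1, h2] with n hn1 hn2 h
      exact h.elim hn1 hn2
    · have hne : θ₁ ≠ θ₀ := by
        rintro rfl
        exact hθ₁.2 (Metric.mem_ball_self Nat.one_div_pos_of_nat)
      obtain ⟨r, hr, h⟩ := hloc θ₁ hθ₁.1 hne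
      exact ⟨_, mem_nhdsWithin_of_mem_nhds (Metric.ball_mem_nhds θ₁ hr), h⟩
  filter_upwards [ae_all_iff.mpr hout, hhat] with ω h1 h2
  rw [Metric.tendsto_nhds]
  intro ε hε
  obtain ⟨k, hk⟩ := exists_nat_one_div_lt hε
  filter_upwards [h1 k, eventually_ge_atTop 1] with n hn hn1
  by_contra hcon
  exact hn ⟨(h2 n hn1).1, fun hb => hcon ((Metric.mem_ball.mp hb).trans hk)⟩

/-- In the conditionally heteroscedastic model the expected criterion is uniquely maximized at the
true parameter. -/
theorem integral_criterionTerm_lt [IsProbabilityMeasure P] {γ : ℝ} (hγ : 0 ≤ γ) (hθ₀ : θ₀ ∈ Θ)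
    {f : ℝ → ℝ} {ε X : ℤ → Ω → ℝ} {σ : ℤ → EuclideanSpace ℝ (Fin d) → Ω → ℝ}
    (hmodel : IsHetModel P Θ θ₀ f ε X σ)
    (hident : ∀ θ ∈ Θ, (∀ t, ∀ᵐ ω ∂P, σ t θ ω = σ t θ₀ ω) → θ = θ₀)
    {σt : ℕ → EuclideanSpace ℝ (Fin d) → Ω → ℝ} (hdef : WellDefined P γ Θ f X σ σt)
    (hA1 : A1 P Θ (qTerm γ f X σ)) (hA2 : A2 P Θ (qTerm γ f X σ) qt)
    {θ : EuclideanSpace ℝ (Fin d)} (hθ : θ ∈ Θ) (hne : θ ≠ θ₀) :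
    ∫ ω, qTerm γ f X σ 0 θ ω ∂P < ∫ ω, qTerm γ f X σ 0 θ₀ ω ∂P := by
  by_contra! hle
  refine hne (hident θ hθ fun t => ?_)
  have hpast : pastSigma X (t - 1) ≤ ‹MeasurableSpace Ω› :=
    iSup_le fun s => (hmodel.measurable_obs s).comap_le
  have hm : ∀ η ∈ Θ, Measurable[pastSigma X (t - 1)] (σ t η) := hmodel.volatility_measurable t
  have hindep : IndepFun (fun ω => (σ t θ ω, σ t θ₀ ω)) (ε t) P := by
    rw [IndepFun_iff_Indep]
    refine (indep_of_indep_of_le_right (hmodel.innovation_indep_past t) ?_).symm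
    exact ((hm θ hθ).prodMk (hm θ₀ hθ₀)).comap_le
  -- Identifiability needs equal volatilities at every time, so the inequality at time `0` is
  -- carried to time `t` by stationarity.
  have hle' : ∫ ω, qTerm γ f X σ t θ₀ ω ∂P ≤ ∫ ω, qTerm γ f X σ t θ ω ∂P := by
    have h1 := (isFactor_eval (P := P) (q := qTerm γ f X σ) hθ).integral_eq hA1.2 t
    have h2 := (isFactor_eval (P := P) (q := qTerm γ f X σ) hθ₀).integral_eq hA1.2 t
    rw [h1, h2]
    exact hle
  exact scale_ae_eq_of_integral_dpdTerm_le hγ hmodel.measurable_density hmodel.density_nonneg hdef.1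
    ((hm θ hθ).mono hpast le_rfl) ((hm θ₀ hθ₀).mono hpast le_rfl) (hmodel.measurable_innovation t)
    (hmodel.volatility_pos t θ hθ) (hmodel.volatility_pos t θ₀ hθ₀) (hmodel.innovation_law t)
    (hmodel.innovation_variance t) hindep (hmodel.model_eq t)
    (integrable_criterionTerm hA1 hA2 hθ t) (integrable_criterionTerm hA1 hA2 hθ₀ t)
    (fun h => by filter_upwards [hdef.2 h] with ω hω using (hω θ hθ).1 t) hle'

end Consistency

/-! ### Derivatives of random functions and a mean value inequality for gradients -/

section Derivatives

variable {d : ℕ}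

lemma eq_sum_single (v : EuclideanSpace ℝ (Fin d)) :
    v = ∑ i, v i • EuclideanSpace.single i (1 : ℝ) := by
  ext j
  simp [Pi.single_apply]

lemma norm_le_vecL1 (v : EuclideanSpace ℝ (Fin d)) : ‖v‖ ≤ vecL1 v := by
  conv_lhs => rw [eq_sum_single v]
  refine (norm_sum_le _ _).trans (Finset.sum_le_sum fun i _ => ?_)
  rw [norm_smul]
  simp

lemma abs_apply_le_norm (v : EuclideanSpace ℝ (Fin d)) (i : Fin d) : |v i| ≤ ‖v‖ := by
  simpa using PiLp.norm_apply_le v i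

lemma gradient_apply (g : EuclideanSpace ℝ (Fin d) → ℝ) (θ : EuclideanSpace ℝ (Fin d))
    (i : Fin d) : gradient g θ i = fderiv ℝ g θ (EuclideanSpace.single i 1) := by
  rw [← inner_gradient_left, EuclideanSpace.inner_single_right]
  simp

lemma contDiffAt_fderiv_apply {g : EuclideanSpace ℝ (Fin d) → ℝ}
    {θ : EuclideanSpace ℝ (Fin d)} (hg : ContDiffAt ℝ 2 g θ) (v : EuclideanSpace ℝ (Fin d)) :
    ContDiffAt ℝ 1 (fun η => fderiv ℝ g η v) θ :=
  (hg.fderiv_right (m := 1) (by norm_num)).clm_apply contDiffAt_const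

lemma continuousAt_hessian {g : EuclideanSpace ℝ (Fin d) → ℝ}
    {θ : EuclideanSpace ℝ (Fin d)} (hg : ContDiffAt ℝ 2 g θ) (i j : Fin d) :
    ContinuousAt (fun η => hessian g η i j) θ :=
  (((contDiffAt_fderiv_apply hg _).fderiv_right (m := 0) (by norm_num)).clm_apply
    contDiffAt_const).continuousAt

lemma abs_le_matL1 (M : Matrix (Fin d) (Fin d) ℝ) (i j : Fin d) : |M i j| ≤ matL1 M :=
  (Finset.single_le_sum (f := fun j => |M i j|) (fun _ _ => abs_nonneg _) (Finset.mem_univ j)).trans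
    (Finset.single_le_sum (f := fun i => ∑ j, |M i j|)
      (fun _ _ => Finset.sum_nonneg fun _ _ => abs_nonneg _) (Finset.mem_univ i))

lemma gradient_sum {ι : Type*} {s : Finset ι} {g : ι → EuclideanSpace ℝ (Fin d) → ℝ}
    {θ : EuclideanSpace ℝ (Fin d)} (hg : ∀ t ∈ s, DifferentiableAt ℝ (g t) θ) :
    gradient (fun η => ∑ t ∈ s, g t η) θ = ∑ t ∈ s, gradient (g t) θ := by
  simp only [gradient]
  rw [fderiv_fun_sum hg, map_sum]

lemma hessian_sum {ι : Type*} {s : Finset ι} {g : ι → EuclideanSpace ℝ (Fin d) → ℝ}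
    {B : Set (EuclideanSpace ℝ (Fin d))} (hB : IsOpen B)
    (hg : ∀ t ∈ s, ∀ θ ∈ B, ContDiffAt ℝ 2 (g t) θ) {θ : EuclideanSpace ℝ (Fin d)} (hθ : θ ∈ B)
    (i j : Fin d) :
    hessian (fun η => ∑ t ∈ s, g t η) θ i j = ∑ t ∈ s, hessian (g t) θ i j := by
  -- To differentiate again, additivity of the first derivative is needed on a whole neighbourhood,
  -- hence the open set `B`.
  have h : (fun η => fderiv ℝ (fun η => ∑ t ∈ s, g t η) η (EuclideanSpace.single j 1))
      =ᶠ[𝓝 θ] fun η => ∑ t ∈ s, fderiv ℝ (g t) η (EuclideanSpace.single j 1) := by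
    filter_upwards [hB.mem_nhds hθ] with η hη
    rw [fderiv_fun_sum fun t ht => (hg t ht η hη).differentiableAt (by norm_num)]
    simp
  simp only [hessian]
  rw [h.fderiv_eq, fderiv_fun_sum fun t ht =>
    (contDiffAt_fderiv_apply (hg t ht θ hθ) _).differentiableAt (by norm_num)]
  simp

/-- A function whose Hessian is entrywise close to a matrix on a convex set has an almost linear
gradient there. -/
theorem norm_gradient_sub_sub_le {g : EuclideanSpace ℝ (Fin d) → ℝ}
    {B : Set (EuclideanSpace ℝ (Fin d))} (hB : Convex ℝ B) (hg : ∀ z ∈ B, ContDiffAt ℝ 2 g z)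
    {A : Matrix (Fin d) (Fin d) ℝ} {C : ℝ}
    (hH : ∀ z ∈ B, ∀ i j, |hessian g z i j - A j i| ≤ C)
    {x y : EuclideanSpace ℝ (Fin d)} (hx : x ∈ B) (hy : y ∈ B) :
    ‖gradient g y - gradient g x - Matrix.toEuclideanCLM (𝕜 := ℝ) A (y - x)‖
      ≤ d * (d * C) * ‖y - x‖ := by
  have hcomp : ∀ j, |(gradient g y - gradient g x - Matrix.toEuclideanCLM (𝕜 := ℝ) A (y - x)) j|
      ≤ d * C * ‖y - x‖ := fun j => by
    -- `hessian g z i j` differentiates the `j`-th partial derivative in direction `i`, so it is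
    -- matched with row `j` of `A`. One factor `d` in the bound comes from the operator norm, the
    -- other from summing over `j`.
    set ℓ : EuclideanSpace ℝ (Fin d) →L[ℝ] ℝ :=
      (EuclideanSpace.proj j).comp (Matrix.toEuclideanCLM (𝕜 := ℝ) A) with hℓ
    have h := hB.norm_image_sub_le_of_norm_fderiv_le'
      (f := fun η => fderiv ℝ g η (EuclideanSpace.single j 1)) (φ := ℓ) (C := d * C)
      (fun z hz => (contDiffAt_fderiv_apply (hg z hz) _).differentiableAt (by norm_num))
      (fun z hz => ?_) hx hy
    · simpa [gradient_apply, hℓ, Real.norm_eq_abs] using h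
    · have hC : 0 ≤ C := (abs_nonneg _).trans (hH z hz j j)
      refine ContinuousLinearMap.opNorm_le_bound _ (by positivity) fun v => ?_
      conv_lhs => rw [eq_sum_single v]
      rw [map_sum]
      calc ‖∑ i, (fderiv ℝ (fun η => fderiv ℝ g η (EuclideanSpace.single j 1)) z - ℓ)
              (v i • EuclideanSpace.single i (1 : ℝ))‖
          ≤ ∑ i : Fin d, C * ‖v‖ := by
            refine (norm_sum_le _ _).trans (Finset.sum_le_sum fun i _ => ?_)
            have hAe : ℓ (EuclideanSpace.single i (1 : ℝ)) = A j i := by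
              simp [hℓ, Matrix.ofLp_toEuclideanCLM]
            rw [map_smul, norm_smul, sub_apply, hAe, mul_comm,
              Real.norm_eq_abs, Real.norm_eq_abs]
            exact mul_le_mul (hH z hz i j) (abs_apply_le_norm v i) (abs_nonneg _) hC
        _ = d * C * ‖v‖ := by
            simp
            ring
  refine (norm_le_vecL1 _).trans ((Finset.sum_le_sum fun j _ => hcomp j).trans ?_)
  simp
  exact le_of_eq (by ring)

variable {Ω S : Type*} [MeasurableSpace Ω] [MeasurableSpace S] {P : Measure Ω} {Y : ℤ → Ω → S}

/-- Directional derivatives of a random function are factors of a sequence as soon as its values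
are. -/
lemma IsFactor.fderiv_apply {Z : ℤ → EuclideanSpace ℝ (Fin d) → Ω → ℝ}
    {B : Set (EuclideanSpace ℝ (Fin d))} (hB : IsOpen B)
    (hZ : ∀ θ ∈ B, IsFactor P Y (fun t => Z t θ)) {θ : EuclideanSpace ℝ (Fin d)} (hθ : θ ∈ B)
    (hd : ∀ t, ∀ᵐ ω ∂P, DifferentiableAt ℝ (fun η => Z t η ω) θ) (v : EuclideanSpace ℝ (Fin d)) :
    IsFactor P Y (fun t ω => fderiv ℝ (fun η => Z t η ω) θ v) := by
  have hlim : Tendsto (fun k : ℕ => θ + ((k : ℝ))⁻¹ • v) atTop (𝓝 θ) := by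
    have h : Tendsto (fun k : ℕ => ((k : ℝ))⁻¹ • v) atTop (𝓝 ((0 : ℝ) • v)) :=
      tendsto_inv_atTop_nhds_zero_nat.smul_const v
    simpa using h.const_add θ
  -- Starting the difference quotients at index `K` keeps all their base points in `B`, where the
  -- values are factors.
  obtain ⟨K, hK⟩ := eventually_atTop.mp (hlim (hB.mem_nhds hθ))
  refine IsFactor.of_tendsto (Z := fun k t ω => ((k + K : ℕ) : ℝ) *
    (Z t (θ + (((k + K : ℕ) : ℝ))⁻¹ • v) ω - Z t θ ω)) (fun k => ?_) (fun t => ?_)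
  · exact ((hZ _ (hK (k + K) (Nat.le_add_left K k))).prodMk (hZ θ hθ)).comp
      (φ := fun z : ℝ × ℝ => ((k + K : ℕ) : ℝ) * (z.1 - z.2)) (by fun_prop)
  · filter_upwards [hd t] with ω hω
    refine hω.hasFDerivAt.lim v (c := fun k : ℕ => ((k + K : ℕ) : ℝ)) ?_
    simp only [Real.norm_natCast]
    exact tendsto_natCast_atTop_atTop.comp (tendsto_add_atTop_nat K)

lemma IsFactor.hessian_apply {Z : ℤ → EuclideanSpace ℝ (Fin d) → Ω → ℝ}
    {B : Set (EuclideanSpace ℝ (Fin d))} (hB : IsOpen B)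
    (hZ : ∀ θ ∈ B, IsFactor P Y (fun t => Z t θ))
    (hd : ∀ t, ∀ᵐ ω ∂P, ∀ θ ∈ B, ContDiffAt ℝ 2 (fun η => Z t η ω) θ)
    {θ : EuclideanSpace ℝ (Fin d)} (hθ : θ ∈ B) (i j : Fin d) :
    IsFactor P Y (fun t ω => hessian (fun η => Z t η ω) θ i j) := by
  refine IsFactor.fderiv_apply (Z := fun t η ω =>
    fderiv ℝ (fun η => Z t η ω) η (EuclideanSpace.single j 1)) hB (fun η hη => ?_) hθ
    (fun t => ?_) _
  · refine IsFactor.fderiv_apply hB hZ hη (fun t => ?_) _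
    filter_upwards [hd t] with ω hω
    exact (hω η hη).differentiableAt (by norm_num)
  · filter_upwards [hd t] with ω hω
    exact (contDiffAt_fderiv_apply (hω θ hθ) _).differentiableAt (by norm_num)

end Derivatives

/-! ### The central limit theorem for the score -/

section Score

lemma pastSigma_mono {Ω : Type*} (X : ℤ → Ω → ℝ) : Monotone (pastSigma X) := fun _ t hst =>
  iSup_le fun r => le_iSup (fun r : {r : ℤ // r ≤ t} => MeasurableSpace.comap (X r) inferInstance)
    ⟨r.1, r.2.trans hst⟩

variable {Ω : Type*} [MeasurableSpace Ω] {d : ℕ} {P : Measure Ω}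
  {Θ : Set (EuclideanSpace ℝ (Fin d))} {θ₀ : EuclideanSpace ℝ (Fin d)} {X : ℤ → Ω → ℝ}
  {q : ℤ → EuclideanSpace ℝ (Fin d) → Ω → ℝ} {qt : ℕ → EuclideanSpace ℝ (Fin d) → Ω → ℝ}

lemma sum_Icc_one_eq_sum_range {M : Type*} [AddCommMonoid M] (a : ℕ → M) (n : ℕ) :
    ∑ t ∈ Finset.Icc 1 n, a t = ∑ k ∈ Finset.range n, a (k + 1) := by
  rw [Finset.range_eq_Ico, Finset.sum_Ico_add' a 0 n 1]
  rfl

lemma inner_eq_sum_mul (x u : EuclideanSpace ℝ (Fin d)) : inner ℝ x u = ∑ i, u i * x i := by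
  simp [PiLp.inner_apply]

lemma inner_sq_eq_sum (x u : EuclideanSpace ℝ (Fin d)) :
    inner ℝ x u ^ 2 = ∑ i, ∑ j, u i * u j * (x i * x j) := by
  rw [inner_eq_sum_mul, sq, Finset.sum_mul_sum]
  exact Finset.sum_congr rfl fun i _ => Finset.sum_congr rfl fun j _ => by ring

/-- The second moment of a linear form of the score is given by the matrix `I`. -/
lemma integral_inner_score_sq
    (hI : ∀ i j, Integrable (fun ω =>
      gradient (fun η => q 0 η ω) θ₀ i * gradient (fun η => q 0 η ω) θ₀ j) P)
    (u : EuclideanSpace ℝ (Fin d)) :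
    Integrable (fun ω => inner ℝ (gradient (fun η => q 0 η ω) θ₀) u ^ 2) P ∧
      ∫ ω, inner ℝ (gradient (fun η => q 0 η ω) θ₀) u ^ 2 ∂P
        = inner ℝ u (Matrix.toEuclideanCLM (𝕜 := ℝ) (matI P θ₀ q) u) := by
  simp only [inner_sq_eq_sum]
  have h1 : ∀ i j, Integrable (fun ω => u i * u j *
      (gradient (fun η => q 0 η ω) θ₀ i * gradient (fun η => q 0 η ω) θ₀ j)) P := fun i j =>
    (hI i j).const_mul _
  refine ⟨integrable_finsetSum _ fun i _ => integrable_finsetSum _ fun j _ => h1 i j, ?_⟩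
  rw [integral_finsetSum _ fun i _ => integrable_finsetSum _ fun j _ => h1 i j,
    Matrix.inner_toEuclideanCLM]
  simp only [dotProduct, Matrix.mulVec, Finset.mul_sum]
  refine Finset.sum_congr rfl fun i _ => ?_
  rw [integral_finsetSum _ fun j _ => h1 i j]
  refine Finset.sum_congr rfl fun j _ => ?_
  rw [integral_const_mul, matI]
  ring

lemma pastSigma_le (hX : ∀ t, Measurable (X t)) (t : ℤ) : pastSigma X t ≤ ‹MeasurableSpace Ω› :=
  iSup_le fun s => (hX s).comap_le

lemma posSemidef_matI
    (hI : ∀ i j, Integrable (fun ω =>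
      gradient (fun η => q 0 η ω) θ₀ i * gradient (fun η => q 0 η ω) θ₀ j) P) :
    (matI P θ₀ q).PosSemidef := by
  refine Matrix.PosSemidef.of_dotProduct_mulVec_nonneg ?_ fun x => ?_
  · ext i j
    simp only [Matrix.conjTranspose_apply, matI, star_trivial]
    exact integral_congr_ae (ae_of_all _ fun ω => mul_comm _ _)
  · have h := (integral_inner_score_sq hI (WithLp.toLp 2 x)).2
    rw [Matrix.inner_toEuclideanCLM] at h
    rw [star_trivial, ← h]
    exact integral_nonneg fun ω => sq_nonneg _

/-- The normalized score converges in the sense of characteristic functions. -/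
theorem tendsto_integral_exp_score [IsProbabilityMeasure P] (hX : ∀ t, Measurable (X t))
    (hY : StationaryErgodic P (fun t ω (θ : Θ) => q t θ ω)) (hθ₀ : θ₀ ∈ interior Θ)
    (hd : ∀ t, ∀ᵐ ω ∂P, DifferentiableAt ℝ (fun η => q t η ω) θ₀) (hA3 : A3 P θ₀ X q)
    (hI : ∀ i j, Integrable (fun ω =>
      gradient (fun η => q 0 η ω) θ₀ i * gradient (fun η => q 0 η ω) θ₀ j) P)
    (u : EuclideanSpace ℝ (Fin d)) :
    Tendsto (fun n : ℕ => ∫ ω, Complex.exp ((inner ℝ ((1 / √(n : ℝ)) •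
      ∑ t ∈ Finset.Icc 1 n, gradient (fun η => q t η ω) θ₀) u : ℝ) * Complex.I) ∂P) atTop
      (𝓝 (Complex.exp (-((inner ℝ u (Matrix.toEuclideanCLM (𝕜 := ℝ) (matI P θ₀ q) u) : ℝ) : ℂ)
        / 2))) := by
  set ξ : ℤ → Ω → EuclideanSpace ℝ (Fin d) := fun t ω => gradient (fun η => q t η ω) θ₀ with hξ
  have hfac : IsFactor P (fun t ω (θ : Θ) => q t θ ω) (fun t ω => inner ℝ (ξ t ω) u) := by
    simp only [hξ, inner_gradient_left]
    exact IsFactor.fderiv_apply isOpen_interior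
      (fun θ hθ => isFactor_eval (interior_subset hθ)) hθ₀ hd u
  have hfac2 : IsFactor P (fun t ω (θ : Θ) => q t θ ω) (fun t ω => inner ℝ (ξ t ω) u ^ 2) :=
    hfac.comp (φ := fun z : ℝ => z ^ 2) (by fun_prop)
  obtain ⟨hsq, hv⟩ := integral_inner_score_sq hI u
  have hinner : ∀ t ω, inner ℝ (ξ t ω) u = innerSL ℝ u (ξ t ω) := fun t ω => by
    rw [innerSL_apply_apply, real_inner_comm]
  rw [← hv]
  -- The `k`-th difference is the score at time `k + 1`, so that its past is `F k` and the sum over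
  -- `k < n` runs over times `1` to `n`.
  refine (tendsto_integral_exp_martingaleDifference (P := P) (F := fun k : ℕ => pastSigma X k)
    (X := fun k ω => inner ℝ (ξ ((k : ℤ) + 1) ω) u)
    (fun a b hab => pastSigma_mono X (by exact_mod_cast hab)) (fun k => pastSigma_le hX k)
    (fun k => ?_) (fun k => ?_) (fun k => ?_) (fun k => hfac2.integrable hY hsq _)
    (fun k => hfac2.integral_eq hY _) ?_).congr fun n => ?_
  · have := (innerSL ℝ u).continuous.comp_aestronglyMeasurable (hA3 ((k : ℤ) + 1)).1
    simp only [hinner]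
    exact this
  · simp only [hinner]
    exact (innerSL ℝ u).integrable_comp (hA3 ((k : ℤ) + 1)).2.1
  · have h1 := ContinuousLinearMap.comp_condExp_comm (m := pastSigma X k)
      (hA3 ((k : ℤ) + 1)).2.1 (innerSL ℝ u)
    have h2 := (hA3 ((k : ℤ) + 1)).2.2
    rw [add_sub_cancel_right] at h2
    simp only [hinner]
    refine h1.symm.trans ?_
    filter_upwards [h2] with ω hω
    simp [hω]
  · filter_upwards [hfac2.tendsto_average hY hsq] with ω hω
    refine hω.congr fun n => ?_
    rw [sum_Icc_one_eq_sum_range (fun t : ℕ => inner ℝ (ξ t ω) u ^ 2)]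
    push_cast
    rfl
  · refine integral_congr_ae (ae_of_all _ fun ω => ?_)
    simp only
    rw [mul_comm Complex.I, sum_Icc_one_eq_sum_range (fun t : ℕ => ξ t ω), real_inner_smul_left,
      sum_inner, ← Complex.ofReal_sum, Finset.mul_sum]
    congr 4
    ext k
    push_cast
    ring

end Score

/-! ### Asymptotic normality -/

section Normality

variable {Ω : Type*} [MeasurableSpace Ω] {d : ℕ} {P : Measure Ω}
  {Θ : Set (EuclideanSpace ℝ (Fin d))} {θ₀ : EuclideanSpace ℝ (Fin d)} {X : ℤ → Ω → ℝ}
  {q : ℤ → EuclideanSpace ℝ (Fin d) → Ω → ℝ} {qt : ℕ → EuclideanSpace ℝ (Fin d) → Ω → ℝ}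

/-- Near `θ₀` the Hessian of the feasible criterion is uniformly close to `-n J`. -/
theorem exists_ball_hessian_criterion_sub_le [IsProbabilityMeasure P]
    (hY : StationaryErgodic P (fun t ω (θ : Θ) => q t θ ω)) (hθ₀ : θ₀ ∈ interior Θ)
    (hTD : TwiceDifferentiable P θ₀ q qt) (hA5 : A5 P θ₀ q qt) (hA6 : A6 P θ₀ q)
    {ε : ℝ} (hε : 0 < ε) :
    ∃ r > 0, ∀ᵐ ω ∂P, ∀ᶠ n : ℕ in atTop, ∀ θ ∈ Metric.ball θ₀ r, ∀ i j,
      |hessian (fun η => criterion qt n η ω) θ i j + n * matJ P θ₀ q i j| ≤ n * ε := by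
  obtain ⟨N, hN, hTD⟩ := hTD
  obtain ⟨N₁, hN₁, hA5⟩ := hA5
  obtain ⟨N₂, hN₂, hA6⟩ := hA6
  -- One ball on which the criterion terms are factors, are smooth, and satisfy the Hessian bounds
  -- of A5 and A6.
  obtain ⟨R, hR, hsub⟩ := Metric.mem_nhds_iff.mp
    (inter_mem (inter_mem (isOpen_interior.mem_nhds hθ₀) hN) (inter_mem hN₁ hN₂))
  set B := Metric.ball θ₀ R with hB
  have hBo : IsOpen B := Metric.isOpen_ball
  have hBΘ : ∀ θ ∈ B, θ ∈ Θ := fun θ hθ => interior_subset (hsub hθ).1.1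
  have hC2 : ∀ t, ∀ᵐ ω ∂P, ∀ θ ∈ B, ContDiffAt ℝ 2 (fun η => q t η ω) θ := fun t => by
    filter_upwards [hTD] with ω hω θ hθ using (hω θ (hsub hθ).1.2).1 t
  have hloc : ∀ i j, ∃ r > 0, ∀ᵐ ω ∂P, ∀ᶠ n : ℕ in atTop, ∀ θ ∈ B ∩ Metric.ball θ₀ r,
      |(∑ t ∈ Finset.Icc 1 n, hessian (fun η => q t η ω) θ i j) / (n : ℝ)
        - ∫ ω, hessian (fun η => q 0 η ω) θ₀ i j ∂P| ≤ ε / 2 := fun i j =>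
    exists_ball_average_sub_le hY (Z := fun t θ ω => hessian (fun η => q t η ω) θ i j)
      (fun θ hθ => IsFactor.hessian_apply hBo (fun η hη => isFactor_eval (hBΘ η hη)) hC2 hθ i j)
      (fun t => by
        filter_upwards [hC2 t] with ω hω θ hθ
        exact (continuousAt_hessian (hω θ hθ) i j).continuousWithinAt)
      (lt_of_le_of_lt (lintegral_mono fun ω => iSup₂_le fun θ hθ =>
        le_iSup₂_of_le (f := fun θ _ => ENNReal.ofReal (matL1 (hessian (fun η => q 0 η ω) θ)))
          θ (hsub hθ).2.2 (ENNReal.ofReal_le_ofReal (abs_le_matL1 _ i j))) (hA6 0))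
      (Metric.mem_ball_self hR) (half_pos hε)
  choose r hr hloc using hloc
  have hsmall : ∃ r₀ > 0, r₀ ≤ R ∧ ∀ i j, r₀ ≤ r i j := by
    have h : ∀ᶠ x in 𝓝[>] (0 : ℝ), x ≤ R ∧ ∀ i j, x ≤ r i j := by
      refine (eventually_nhdsWithin_of_eventually_nhds (eventually_le_nhds hR)).and ?_
      rw [eventually_all]
      intro i
      rw [eventually_all]
      exact fun j => eventually_nhdsWithin_of_eventually_nhds (eventually_le_nhds (hr i j))
    obtain ⟨x, hx, hx0⟩ := (h.and self_mem_nhdsWithin).exists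
    exact ⟨x, hx0, hx.1, hx.2⟩
  obtain ⟨r₀, hr₀, hr₀R, hr₀r⟩ := hsmall
  refine ⟨r₀, hr₀, ?_⟩
  filter_upwards [ae_all_iff.mpr fun i => ae_all_iff.mpr fun j => hloc i j, hTD, hA5]
    with ω h1 h2 h3
  have h1' : ∀ᶠ n : ℕ in atTop, ∀ i j, ∀ θ ∈ B ∩ Metric.ball θ₀ (r i j),
      |(∑ t ∈ Finset.Icc 1 n, hessian (fun η => q t η ω) θ i j) / (n : ℝ)
        - ∫ ω, hessian (fun η => q 0 η ω) θ₀ i j ∂P| ≤ ε / 2 := by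
    simp only [eventually_all]
    exact h1
  have h3' := eventually_forall_average_le (K := N₁)
    (u := fun t θ => matL1 (hessian (fun η => q t η ω) θ - hessian (fun η => qt t η ω) θ))
    (fun t θ _ => Finset.sum_nonneg fun _ _ => Finset.sum_nonneg fun _ _ => abs_nonneg _)
    h3 (half_pos hε)
  filter_upwards [h1', h3', eventually_gt_atTop 0] with n hn1 hn2 hn0 θ hθ i j
  have hn' : (0 : ℝ) < n := by exact_mod_cast hn0
  have hθB : θ ∈ B := Metric.ball_subset_ball hr₀R hθ
  have h4 := hn1 i j θ ⟨hθB, Metric.ball_subset_ball (hr₀r i j) hθ⟩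
  have h5 := hn2 θ (hsub hθB).2.1
  have h6 : |(∑ t ∈ Finset.Icc 1 n, hessian (fun η => q t η ω) θ i j) / (n : ℝ)
      - (∑ t ∈ Finset.Icc 1 n, hessian (fun η => qt t η ω) θ i j) / (n : ℝ)| ≤ ε / 2 := by
    refine le_trans ?_ h5
    rw [← sub_div, ← Finset.sum_sub_distrib, abs_div, Nat.abs_cast]
    gcongr
    exact (Finset.abs_sum_le_sum_abs _ _).trans (Finset.sum_le_sum fun t _ =>
      abs_le_matL1 (hessian (fun η => q t η ω) θ - hessian (fun η => qt t η ω) θ) i j)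
  have h7 : hessian (fun η => criterion qt n η ω) θ i j
      = ∑ t ∈ Finset.Icc 1 n, hessian (fun η => qt t η ω) θ i j :=
    hessian_sum hBo (fun t ht η hη => (h2 η (hsub hη).1.2).2 t (Finset.mem_Icc.mp ht).1) hθB i j
  have h8 : hessian (fun η => criterion qt n η ω) θ i j + n * matJ P θ₀ q i j
      = n * ((∑ t ∈ Finset.Icc 1 n, hessian (fun η => qt t η ω) θ i j) / (n : ℝ)
        - ∫ ω, hessian (fun η => q 0 η ω) θ₀ i j ∂P) := by
    rw [h7, matJ]
    field_simp
    ring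
  rw [h8, abs_mul, Nat.abs_cast]
  gcongr
  rw [abs_le] at h4 h6 ⊢
  constructor <;> linarith [h4.1, h4.2, h6.1, h6.2]

/-- The feasible score at `θ₀` is asymptotically a linear function of the estimation error. -/
theorem eventually_norm_gradient_criterion_sub_le [IsProbabilityMeasure P]
    (hY : StationaryErgodic P (fun t ω (θ : Θ) => q t θ ω)) (hθ₀ : θ₀ ∈ interior Θ)
    (hTD : TwiceDifferentiable P θ₀ q qt) (hA5 : A5 P θ₀ q qt) (hA6 : A6 P θ₀ q)
    (hJ : (matJ P θ₀ q).IsHermitian) {θhat : ℕ → Ω → EuclideanSpace ℝ (Fin d)}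
    (hθhat : IsMDPDE P Θ qt θhat)
    (hcons : ∀ᵐ ω ∂P, Tendsto (fun n => θhat n ω) atTop (𝓝 θ₀)) {ε : ℝ} (hε : 0 < ε) :
    ∀ᵐ ω ∂P, ∀ᶠ n : ℕ in atTop,
      ‖(n : ℝ) • Matrix.toEuclideanCLM (𝕜 := ℝ) (matJ P θ₀ q) (θhat n ω - θ₀)
        - ∑ t ∈ Finset.Icc 1 n, gradient (fun η => qt t η ω) θ₀‖ ≤ n * ε * ‖θhat n ω - θ₀‖ := by
  -- The mean value inequality costs a factor `d * d`; the `+ 1` covers `d = 0`.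
  set ε' : ℝ := ε / ((d : ℝ) * d + 1) with hε'
  have hε'0 : 0 < ε' := by positivity
  obtain ⟨r, hr, hball⟩ := exists_ball_hessian_criterion_sub_le hY hθ₀ hTD hA5 hA6 hε'0
  obtain ⟨N, hN, hTD⟩ := hTD
  obtain ⟨R, hR, hsub⟩ := Metric.mem_nhds_iff.mp (inter_mem
    (inter_mem (isOpen_interior.mem_nhds hθ₀) hN) (Metric.ball_mem_nhds θ₀ hr))
  have hmax : ∀ᵐ ω ∂P, ∀ n, 1 ≤ n → IsMaxOn (fun θ => criterion qt n θ ω) Θ (θhat n ω) := by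
    rw [ae_all_iff]
    intro n
    by_cases hn : 1 ≤ n
    · filter_upwards [hθhat.2 n hn] with ω hω _ using hω.2
    · exact ae_of_all _ fun ω h => absurd h hn
  filter_upwards [hball, hTD, hmax, hcons] with ω h1 h2 h3 h4
  filter_upwards [h1, h4 (Metric.ball_mem_nhds θ₀ hR), eventually_ge_atTop 1] with n hn1 hn2 hn3
  have hn2' : θhat n ω ∈ Metric.ball θ₀ R := hn2
  have hdiff : ∀ t ∈ Finset.Icc 1 n, ∀ θ ∈ Metric.ball θ₀ R,
      ContDiffAt ℝ 2 (fun η => qt t η ω) θ := fun t ht θ hθ =>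
    (h2 θ (hsub hθ).1.2).2 t (Finset.mem_Icc.mp ht).1
  have hgrad0 : gradient (fun η => criterion qt n η ω) (θhat n ω) = 0 := by
    have hloc : IsLocalMax (fun η => criterion qt n η ω) (θhat n ω) :=
      (h3 n hn3).isLocalMax (mem_interior_iff_mem_nhds.mp (hsub hn2').1.1)
    rw [gradient, hloc.fderiv_eq_zero, map_zero]
  have hgradS : gradient (fun η => criterion qt n η ω) θ₀
      = ∑ t ∈ Finset.Icc 1 n, gradient (fun η => qt t η ω) θ₀ :=
    gradient_sum fun t ht =>
      (hdiff t ht θ₀ (Metric.mem_ball_self hR)).differentiableAt (by norm_num)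
  have h := norm_gradient_sub_sub_le (g := fun η => criterion qt n η ω)
    (A := -((n : ℝ) • matJ P θ₀ q)) (C := n * ε') (convex_ball θ₀ R)
    (fun z hz => ContDiffAt.sum fun t ht => hdiff t ht z hz) (fun z hz i j => ?_)
    (Metric.mem_ball_self hR) hn2'
  · rw [hgrad0, hgradS, zero_sub, map_neg, map_smul] at h
    simp only [neg_apply, smul_apply, sub_neg_eq_add] at h
    rw [sub_eq_neg_add]
    refine h.trans ?_
    have hc : (d : ℝ) * (d * (n * ε')) ≤ n * ε := by
      have : (d : ℝ) * d * ε' ≤ ε := by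
        rw [hε', mul_div_assoc', div_le_iff₀ (by positivity)]
        nlinarith
      nlinarith [Nat.cast_nonneg (α := ℝ) n]
    gcongr
  -- The mean value inequality compares with the transposed entry, which symmetry of `J` makes
  -- harmless.
  · have h5 := hn1 z (hsub hz).2 i j
    have h6 : matJ P θ₀ q j i = matJ P θ₀ q i j := by
      simpa using hJ.apply i j
    simpa [h6] using h5

/-- If `T` is invertible and `T Δ_n - M_n` is negligible with respect to `Δ_n`, then the distance
of `Δ_n` to `T⁻¹ M_n` is negligible with respect to `1 + ‖T⁻¹ M_n‖`. -/
lemma tendsto_smul_sub_of_linearization {E : Type*} [NormedAddCommGroup E] [NormedSpace ℝ E]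
    {T L : E →L[ℝ] E} (hLT : ∀ x, L (T x) = x) {Δ M G : ℕ → E}
    (hGM : Tendsto (fun n => ‖M n - G n‖) atTop (𝓝 0))
    (hlin : ∀ ε > 0, ∀ᶠ n in atTop, ‖T (Δ n) - G n‖ ≤ ε * ‖Δ n‖) :
    Tendsto (fun n => (1 + ‖L (M n)‖)⁻¹ • (Δ n - L (M n))) atTop (𝓝 0) := by
  rw [Metric.tendsto_nhds]
  intro δ hδ
  set c : ℝ := ‖L‖ + 1
  have hc : 0 < c := by positivity
  -- The first bound absorbs `‖Δ - L M‖` into the left-hand side; the second leaves at most `δ / 2`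
  -- times `1 + ‖L M‖`.
  set ε : ℝ := min (1 / (2 * c)) (δ / (4 * c)) with hε
  have hε0 : 0 < ε := by positivity
  filter_upwards [hlin ε hε0, hGM.eventually_lt_const hε0] with n h1 h2
  have h3 : ‖Δ n - L (M n)‖ ≤ c * (ε * ‖Δ n‖ + ε) := by
    have e : Δ n - L (M n) = L (T (Δ n) - G n - (M n - G n)) := by
      rw [sub_sub_sub_cancel_right, map_sub, hLT]
    rw [e]
    refine (L.le_opNorm _).trans ?_
    have h4 := norm_sub_le (T (Δ n) - G n) (M n - G n)
    exact mul_le_mul (by simp [c]) (by linarith) (norm_nonneg _) hc.le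
  have h5 : ‖Δ n‖ ≤ ‖L (M n)‖ + ‖Δ n - L (M n)‖ := by
    simpa using norm_add_le (L (M n)) (Δ n - L (M n))
  have h6 : c * ε ≤ 1 / 2 := by
    calc c * ε ≤ c * (1 / (2 * c)) := mul_le_mul_of_nonneg_left (min_le_left _ _) hc.le
      _ = 1 / 2 := by field_simp
  have h7 : c * ε ≤ δ / 4 := by
    calc c * ε ≤ c * (δ / (4 * c)) := mul_le_mul_of_nonneg_left (min_le_right _ _) hc.le
      _ = δ / 4 := by field_simp
  have hp : 0 < 1 + ‖L (M n)‖ := by positivity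
  have h8 : ‖Δ n - L (M n)‖ ≤ δ / 2 * (1 + ‖L (M n)‖) := by
    have h9 := mul_le_mul_of_nonneg_left h5 (by positivity : 0 ≤ c * ε)
    nlinarith [norm_nonneg (Δ n - L (M n)), norm_nonneg (L (M n))]
  rw [dist_zero_right, norm_smul, Real.norm_of_nonneg (inv_nonneg.mpr hp.le), inv_mul_lt_iff₀ hp]
  nlinarith

/-- A sequence of random vectors whose characteristic functions converge to that of a centred
Gaussian vector converges in distribution to it. -/
lemma tendstoInDistribution_multivariateGaussian [IsProbabilityMeasure P]
    {Y : ℕ → Ω → EuclideanSpace ℝ (Fin d)} (hY : ∀ n, AEMeasurable (Y n) P)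
    {S : Matrix (Fin d) (Fin d) ℝ} (hS : S.PosSemidef)
    (h : ∀ x : EuclideanSpace ℝ (Fin d), Tendsto (fun n : ℕ =>
      ∫ ω, Complex.exp ((inner ℝ (Y n ω) x : ℝ) * Complex.I) ∂P) atTop
      (𝓝 (Complex.exp (-((inner ℝ x (Matrix.toEuclideanCLM (𝕜 := ℝ) S x) : ℝ) : ℂ) / 2)))) :
    TendstoInDistribution Y atTop id (fun _ => P) (multivariateGaussian 0 S) := by
  refine ⟨hY, aemeasurable_id, ?_⟩
  refine ProbabilityMeasure.tendsto_of_tendsto_charFun fun x => ?_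
  simp only [ProbabilityMeasure.coe_mk, Measure.map_id]
  rw [charFun_multivariateGaussian hS]
  convert h x using 2 with n
  · rw [charFun_apply, integral_map (hY n)]
    exact Measurable.aestronglyMeasurable (by fun_prop)
  · rw [Matrix.inner_toEuclideanCLM]
    simp [neg_div]

/-- Asymptotic normality of the estimator. -/
theorem tendstoInDistribution_mdpde [IsProbabilityMeasure P] (hX : ∀ t, Measurable (X t))
    {θhat : ℕ → Ω → EuclideanSpace ℝ (Fin d)} (hθhat : IsMDPDE P Θ qt θhat)
    (hcons : ∀ᵐ ω ∂P, Tendsto (fun n => θhat n ω) atTop (𝓝 θ₀))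
    (hY : StationaryErgodic P (fun t ω (θ : Θ) => q t θ ω)) (hθ₀ : θ₀ ∈ interior Θ)
    (hTD : TwiceDifferentiable P θ₀ q qt) (hA3 : A3 P θ₀ X q) (hA4 : A4 P θ₀ q qt)
    (hA5 : A5 P θ₀ q qt) (hA6 : A6 P θ₀ q) (hA7 : A7 P θ₀ q) :
    TendstoInDistribution (fun (n : ℕ) ω => √(n : ℝ) • (θhat n ω - θ₀)) atTop id (fun _ => P)
      (multivariateGaussian 0 ((matJ P θ₀ q)⁻¹ * matI P θ₀ q * (matJ P θ₀ q)⁻¹)) := by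
  obtain ⟨-, hI, hJ⟩ := hA7
  set J := matJ P θ₀ q with hJdef
  set T := Matrix.toEuclideanCLM (𝕜 := ℝ) J
  set L := Matrix.toEuclideanCLM (𝕜 := ℝ) J⁻¹ with hL
  have hJinv : J⁻¹.IsHermitian := hJ.inv.isHermitian
  have hLT : ∀ x, L (T x) = x := fun x => by
    have h : L * T = 1 := by
      rw [← map_mul, Matrix.nonsing_inv_mul _ ((Matrix.isUnit_iff_isUnit_det _).mp hJ.isUnit),
        map_one]
    exact congrArg (fun A : EuclideanSpace ℝ (Fin d) →L[ℝ] EuclideanSpace ℝ (Fin d) => A x) h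
  have hLsymm : ∀ x y, inner ℝ (L x) y = inner ℝ x (L y) := fun x y => by
    rw [real_inner_comm, Matrix.inner_toEuclideanCLM, Matrix.inner_toEuclideanCLM,
      Matrix.dotProduct_mulVec, ← Matrix.mulVec_transpose, dotProduct_comm]
    congr 2
  have hS : (J⁻¹ * matI P θ₀ q * J⁻¹).PosSemidef := by
    have := (posSemidef_matI hI).conjTranspose_mul_mul_same J⁻¹
    rwa [hJinv.eq] at this
  set M : ℕ → Ω → EuclideanSpace ℝ (Fin d) := fun n ω =>
    (1 / √(n : ℝ)) • ∑ t ∈ Finset.Icc 1 n, gradient (fun η => q t η ω) θ₀ with hM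
  have hMm : ∀ n, AEMeasurable (M n) P := fun n => by
    have h : AEMeasurable (fun ω => ∑ t ∈ Finset.Icc 1 n, gradient (fun η => q t η ω) θ₀) P :=
      Finset.aemeasurable_fun_sum _ fun t _ =>
        ((hA3 t).1.mono (pastSigma_le hX t)).aemeasurable
    exact h.const_smul (1 / √(n : ℝ))
  have hLMm : ∀ n, AEMeasurable (fun ω => L (M n ω)) P := fun n =>
    L.continuous.measurable.comp_aemeasurable (hMm n)
  have hd : ∀ t, ∀ᵐ ω ∂P, DifferentiableAt ℝ (fun η => q t η ω) θ₀ := fun t => by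
    obtain ⟨N, hN, h⟩ := hTD
    filter_upwards [h] with ω hω
    exact ((hω θ₀ (mem_of_mem_nhds hN)).1 t).differentiableAt (by norm_num)
  have hclt : TendstoInDistribution (fun n ω => L (M n ω)) atTop id (fun _ => P)
      (multivariateGaussian 0 (J⁻¹ * matI P θ₀ q * J⁻¹)) := by
    refine tendstoInDistribution_multivariateGaussian hLMm hS fun x => ?_
    have h := tendsto_integral_exp_score hX hY hθ₀ hd hA3 hI (L x)
    have hv : inner ℝ x (Matrix.toEuclideanCLM (𝕜 := ℝ) (J⁻¹ * matI P θ₀ q * J⁻¹) x)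
        = inner ℝ (L x) (Matrix.toEuclideanCLM (𝕜 := ℝ) (matI P θ₀ q) (L x)) := by
      rw [map_mul, map_mul, hLsymm]
      rfl
    rw [hv]
    refine h.congr fun n => ?_
    simp only [hLsymm, hM]
  -- Countably many tolerances give one null set valid for all of them.
  have hlin : ∀ᵐ ω ∂P, ∀ k : ℕ, ∀ᶠ n : ℕ in atTop,
      ‖(n : ℝ) • T (θhat n ω - θ₀) - ∑ t ∈ Finset.Icc 1 n, gradient (fun η => qt t η ω) θ₀‖
        ≤ n * (1 / ((k : ℝ) + 1)) * ‖θhat n ω - θ₀‖ := by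
    rw [ae_all_iff]
    exact fun k => eventually_norm_gradient_criterion_sub_le hY hθ₀ hTD hA5 hA6 hJ.isHermitian
      hθhat hcons Nat.one_div_pos_of_nat
  -- The score converges only in law and may be unbounded along a path. Dividing by `1 + ‖L M‖`
  -- gives an error that tends to zero almost surely.
  set V : ℕ → Ω → EuclideanSpace ℝ (Fin d) := fun n ω =>
    (1 + ‖L (M n ω)‖)⁻¹ • (√(n : ℝ) • (θhat n ω - θ₀) - L (M n ω)) with hV
  have hVm : ∀ n, AEMeasurable (V n) P := fun n =>
    ((hLMm n).norm.const_add 1).inv.smul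
      ((((hθhat.1 n).sub_const θ₀).const_smul (√(n : ℝ))).sub (hLMm n))
  have hV0 : ∀ᵐ ω ∂P, Tendsto (fun n => V n ω) atTop (𝓝 0) := by
    filter_upwards [hlin, hA4] with ω h1 h2
    refine tendsto_smul_sub_of_linearization (T := T) hLT (G := fun n : ℕ =>
      (1 / √(n : ℝ)) • ∑ t ∈ Finset.Icc 1 n, gradient (fun η => qt t η ω) θ₀) ?_ fun ε hε => ?_
    · refine squeeze_zero (fun n => norm_nonneg _) (fun n => ?_) h2
      simp only [hM]
      rw [← smul_sub, ← Finset.sum_sub_distrib, norm_smul, Real.norm_of_nonneg (by positivity)]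
      gcongr
      exact (norm_sum_le _ _).trans (Finset.sum_le_sum fun t _ => norm_le_vecL1 _)
    · obtain ⟨k, hk⟩ := exists_nat_one_div_lt hε
      filter_upwards [h1 k, eventually_gt_atTop 0] with n hn hn0
      have hs : 0 < √(n : ℝ) := Real.sqrt_pos.mpr (by exact_mod_cast hn0)
      have hsn : √(n : ℝ) * √(n : ℝ) = n := Real.mul_self_sqrt (Nat.cast_nonneg n)
      have e : T (√(n : ℝ) • (θhat n ω - θ₀))
            - (1 / √(n : ℝ)) • ∑ t ∈ Finset.Icc 1 n, gradient (fun η => qt t η ω) θ₀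
          = (1 / √(n : ℝ)) • ((n : ℝ) • T (θhat n ω - θ₀)
            - ∑ t ∈ Finset.Icc 1 n, gradient (fun η => qt t η ω) θ₀) := by
        rw [map_smul, smul_sub, smul_smul]
        congr 2
        field_simp
        rw [sq, hsn]
      rw [e, norm_smul, norm_smul, Real.norm_of_nonneg (by positivity),
        Real.norm_of_nonneg hs.le, div_mul_eq_mul_div, one_mul, div_le_iff₀ hs]
      calc _ ≤ n * (1 / ((k : ℝ) + 1)) * ‖θhat n ω - θ₀‖ := hn
        _ ≤ n * ε * ‖θhat n ω - θ₀‖ := by gcongr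
        _ = ε * (√(n : ℝ) * ‖θhat n ω - θ₀‖) * √(n : ℝ) := by
            linear_combination -(ε * ‖θhat n ω - θ₀‖) * hsn
  have hVmeas : TendstoInMeasure P V atTop fun _ => 0 :=
    tendstoInMeasure_of_tendsto_ae (fun n => (hVm n).aestronglyMeasurable) hV0
  -- The continuous map undoes the normalization: at `(L M, V)` it returns the scaled estimation
  -- error, and at second argument `0` it is the first projection.
  have hslutsky := hclt.continuous_comp_prodMk_of_tendstoInMeasure_const
    (g := fun z : EuclideanSpace ℝ (Fin d) × EuclideanSpace ℝ (Fin d) =>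
      z.1 + (1 + ‖z.1‖) • z.2) (by fun_prop) hVmeas hVm
  refine hslutsky.congr (fun n => ae_of_all _ fun ω => ?_) (ae_of_all _ fun z => by simp)
  have hp : 1 + ‖L (M n ω)‖ ≠ 0 := by positivity
  simp only [hV]
  rw [smul_inv_smul₀ hp, add_sub_cancel]

end Normality

end DPD

theorem theorem1 {Ω : Type*} [MeasurableSpace Ω] (P : Measure Ω) [IsProbabilityMeasure P]
    {d : ℕ} (γ : ℝ) (hγ : 0 ≤ γ)
    (Θ : Set (EuclideanSpace ℝ (Fin d))) (hΘ : IsCompact Θ)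
    (θ₀ : EuclideanSpace ℝ (Fin d)) (hθ₀ : θ₀ ∈ Θ)
    (f : ℝ → ℝ) (ε X : ℤ → Ω → ℝ)
    (σ : ℤ → EuclideanSpace ℝ (Fin d) → Ω → ℝ)
    (hmodel : DPD.IsHetModel P Θ θ₀ f ε X σ)
    (hident : ∀ θ ∈ Θ, (∀ t, ∀ᵐ ω ∂P, σ t θ ω = σ t θ₀ ω) → θ = θ₀)
    (σt : ℕ → EuclideanSpace ℝ (Fin d) → Ω → ℝ)
    (hσt_pos : ∀ t, 1 ≤ t → ∀ θ ∈ Θ, ∀ ω, 0 < σt t θ ω)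
    (hσt_meas : ∀ t, 1 ≤ t → ∀ θ ∈ Θ, Measurable (σt t θ))
    (hdef : DPD.WellDefined P γ Θ f X σ σt)
    (q : ℤ → EuclideanSpace ℝ (Fin d) → Ω → ℝ) (hq : q = DPD.qTerm γ f X σ)
    (qt : ℕ → EuclideanSpace ℝ (Fin d) → Ω → ℝ)
    (hqt : qt = DPD.qTerm γ f (fun t : ℕ => X t) σt)
    (θhat : ℕ → Ω → EuclideanSpace ℝ (Fin d)) (hθhat : DPD.IsMDPDE P Θ qt θhat)
    (hA1 : DPD.A1 P Θ q) (hA2 : DPD.A2 P Θ q qt) :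
    (∀ᵐ ω ∂P, Tendsto (fun n => θhat n ω) atTop (𝓝 θ₀)) ∧
    (θ₀ ∈ interior Θ → DPD.TwiceDifferentiable P θ₀ q qt →
      DPD.A3 P θ₀ X q → DPD.A4 P θ₀ q qt → DPD.A5 P θ₀ q qt → DPD.A6 P θ₀ q →
      DPD.A7 P θ₀ q →
      TendstoInDistribution (fun (n : ℕ) ω => √(n : ℝ) • (θhat n ω - θ₀)) atTop id
        (fun _ => P)
        (multivariateGaussian 0
          ((DPD.matJ P θ₀ q)⁻¹ * DPD.matI P θ₀ q * (DPD.matJ P θ₀ q)⁻¹))) := by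
  subst hq hqt
  have hcons := DPD.tendsto_mdpde hΘ hθ₀ hθhat hA1 hA2 fun θ hθ hne =>
    DPD.integral_criterionTerm_lt hγ hθ₀ hmodel hident hdef hA1 hA2 hθ hne
  exact ⟨hcons, fun hint hTD hA3 hA4 hA5 hA6 hA7 =>
    DPD.tendstoInDistribution_mdpde hmodel.measurable_obs hθhat hcons hA1.2 hint hTD hA3 hA4 hA5
      hA6 hA7⟩
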